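/- Let $X\subset\mathbb{R}^m$ be compact, with the metric $d$ induced by a norm on $\mathbb{R}^m$, and let $\mu$ be a finite Borel measure on $X$ that is absolutely continuous with respect to Lebesgue measure and satisfies $\operatorname{supp}\mu=X$. Let $T:X\to X$ be a continuous bijection with $\mu(B)=\mu(T(B))=\mu(T^{-1}(B))$ for every Borel set $B\subseteq X$, and let $\mathcal U g=g\circ T$ be its Koopman operator, a unitary operator on the complex Hilbert space $L^2(X,\mu)$. **Partitions.** Let $(\mathcal P_n)_{n\ge1}$, $\mathcal P_n=\{p_{n,1},\dots,p_{n,q(n)}\}$, be finite covers of $X$ by compact connected sets with $\mu(p_{n,j})=\mu(X)/q(n)$ for all $j$ (so that different cells overlap only in $\mu$-null sets), where $q$ is strictly increasing, such that $\operatorname{diam}(p_{n,j})\le l(n)$ for a positive monotone sequence $l(n)\to0$, and such that for $n>m$ every cell of $\mathcal P_m$ is a union of cells of $\mathcal P_n$. **Periodic approximation.** Let $T_n:\mathcal P_n\to\mathcal P_n$ be bijections that periodically approximate $T$: for every $k\in\mathbb N$ and every compact $A\subseteq X$, $$\lim_{n\to\infty}\sum_{l=-k}^{k}d_H\bigl(T^l(A),T_n^l(A_n)\bigr)=0,\qquad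 A_n=\bigcup_{p\in\mathcal P_n,\;p\cap A\neq\emptyset}p,\qquad T_n^l(A_n)=\bigcup_{p\in\mathcal P_n,\;p\cap A\ne\emptyset}T_n^l(p),$$ where $d_H$ is the Hausdorff distance. **Discretization.** Let $L^2_n$ be the linear span of the indicator functions $\chi_{p_{n,j}}$ in $L^2(X,\mu)$. For $g\in L^2(X,\mu)$ put $$g_n=\sum_{j=1}^{q(n)}g_{n,j}\chi_{p_{n,j}}\in L^2_n,\qquad g_{n,j}=\frac{q(n)}{\mu(X)}\int_{p_{n,j}}g\,d\mu,$$ and let $\mathcal U_n:L^2_n\to L^2_n$ be given by $\mathcal U_n\bigl(\sum_jc_j\chi_{p_{n,j}}\bigr)=\sum_jc_j\chi_{T_n^{-1}(p_{n,j})}$. **Functional calculi.** A spectral measure of $\mathcal U$ is a projection-valued measure $\mathcal S$ on the Borel sets of $[-\pi,\pi)$ (its values are orthogonal projectors, $\mathcal S_\emptyset=0$, $\mathcal S_{[-\pi,\pi)}=I$, the ranges over disjoint sets are orthogonal, and $D\mapsto\mathcal S_Dg$ is countably additive for every $g$) with $\mathcal U^k=\int e^{ik\theta}\,d\mathcal S(\theta)$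 for all $k\in\mathbb Z$. Here $A=\int\varphi\,d\mathcal S$ means that $\langle g,Ag\rangle=\int\varphi(\theta)\,d\langle g,\mathcal S(\theta)g\rangle$ for all $g$. A spectral decomposition of $\mathcal U_n$ consists of an orthonormal basis $v_{n,1},\dots,v_{n,q(n)}$ of $L^2_n$ and angles $\theta_{n,k}\in[-\pi,\pi)$ with $\mathcal U_nv_{n,k}=e^{i\theta_{n,k}}v_{n,k}$. For a smooth $2\pi$-periodic function $\varphi:\mathbb R\to\mathbb C$ put $$\mathcal S_\varphi=\int\varphi\,d\mathcal S,\qquad \mathcal S_{n,\varphi}h=\sum_{k=1}^{q(n)}\varphi(\theta_{n,k})\,\langle v_{n,k},h\rangle\,v_{n,k}\quad(h\in L^2_n).$$ **Theorem.** The operator $\mathcal U$ has a spectral measure, each $\mathcal U_n$ has a spectral decomposition, and for every spectral measure $\mathcal S$ of $\mathcal U$, all spectral decompositions of the operators $\mathcal U_n$, every smooth $2\pi$-periodic $\varphi:\mathbb R\to\mathbb C$ and every $g\in L^2(X,\mu)$, $$\lim_{n\to\infty}\bigl\|\mathcal S_\varphi g-\mathcal S_{n,\varphi}g_n\bigr\|=0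 .$$ -/

import Mathlib

open MeasureTheory Filter Topology
open scoped ContDiff ENNReal

noncomputable section

namespace KoopmanSpectra

/-! ### Projection-valued measures -/

section PVM

variable {Ω : Type*} [MeasurableSpace Ω]
variable {H : Type*} [NormedAddCommGroup H] [InnerProductSpace ℂ H] [CompleteSpace H]

/-- A projection-valued measure on `Ω` with values in the bounded operators of the complex Hilbert
space `H`. Only the values `proj D` at measurable sets `D` are meaningful. -/
structure ProjectionValuedMeasure (Ω : Type*) [MeasurableSpace Ω]
    (H : Type*) [NormedAddCommGroup H] [InnerProductSpace ℂ H] [CompleteSpace H] where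
  /-- the operator attached to a set -/
  proj : Set Ω → H →L[ℂ] H
  /-- `proj D` is an orthogonal projector -/
  isStarProjection : ∀ D, MeasurableSet D → IsStarProjection (proj D)
  proj_empty : proj ∅ = 0
  proj_univ : proj Set.univ = 1
  inner_eq_zero : ∀ D₁ D₂, MeasurableSet D₁ → MeasurableSet D₂ → Disjoint D₁ D₂ →
    ∀ g h : H, inner ℂ (proj D₁ g) (proj D₂ h) = 0
  tendsto_sum : ∀ D : ℕ → Set Ω, (∀ k, MeasurableSet (D k)) →
    Pairwise (Function.onFun Disjoint D) → ∀ g : H,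
    Tendsto (fun m : ℕ => ∑ k ∈ Finset.range m, proj (D k) g) atTop (𝓝 (proj (⋃ k, D k) g))

namespace ProjectionValuedMeasure

theorem re_inner_nonneg (S : ProjectionValuedMeasure Ω H) (g : H) {D : Set Ω}
    (hD : MeasurableSet D) : 0 ≤ (inner ℂ g (S.proj D g)).re := by
  have h := S.isStarProjection D hD
  have h2 : inner ℂ g (S.proj D g) = inner ℂ (S.proj D g) (S.proj D g) := by
    have hi : S.proj D (S.proj D g) = S.proj D g := by
      have := congrArg (fun A : H →L[ℂ] H => A g) h.isIdempotentElem.eq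
      simpa using this
    have hs := h.isSelfAdjoint.isSymmetric g (S.proj D g)
    simp only [ContinuousLinearMap.coe_coe] at hs
    rw [hs, hi]
  rw [h2]
  exact inner_self_nonneg (𝕜 := ℂ)

/-- The finite positive measure `D ↦ ⟨g, S_D g⟩ = ‖S_D g‖²`. -/
def scalarMeasure (S : ProjectionValuedMeasure Ω H) (g : H) : Measure Ω :=
  Measure.ofMeasurable (fun D _ => ENNReal.ofReal (inner ℂ g (S.proj D g)).re)
    (by simp [S.proj_empty])
    (by
      intro D hD hdisj
      have ht : Tendsto (fun m : ℕ => ∑ k ∈ Finset.range m, (inner ℂ g (S.proj (D k) g)).re)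
          atTop (𝓝 (inner ℂ g (S.proj (⋃ k, D k) g)).re) := by
        have h1 := S.tendsto_sum D hD hdisj g
        have h2 : Continuous fun x : H => (inner ℂ g x).re := by fun_prop
        have h3 := (h2.tendsto _).comp h1
        refine h3.congr fun m => ?_
        simp
      have hs := (hasSum_iff_tendsto_nat_of_nonneg
        (fun k => S.re_inner_nonneg g (hD k)) _).2 ht
      rw [← hs.tsum_eq, ENNReal.ofReal_tsum_of_nonneg
        (fun k => S.re_inner_nonneg g (hD k)) hs.summable])

/-- `A = ∫ φ dS`, in the usual weak sense: `⟨g, A g⟩ = ∫ φ(θ) d⟨g, S(θ) g⟩` for every `g`. On a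
complex Hilbert space this determines the operator `A` (polarization). -/
def HasIntegral (S : ProjectionValuedMeasure Ω H) (φ : Ω → ℂ) (A : H →L[ℂ] H) : Prop :=
  ∀ g : H, Integrable φ (S.scalarMeasure g) ∧ inner ℂ g (A g) = ∫ θ, φ θ ∂(S.scalarMeasure g)

theorem HasIntegral.unique {S : ProjectionValuedMeasure Ω H} {φ : Ω → ℂ} {A B : H →L[ℂ] H}
    (hA : S.HasIntegral φ A) (hB : S.HasIntegral φ B) : A = B := by
  have h : (A : H →ₗ[ℂ] H) = (B : H →ₗ[ℂ] H) := by
    rw [← ext_inner_map]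
    intro g
    have h1 : inner ℂ g (A g) = inner ℂ g (B g) := by rw [(hA g).2, (hB g).2]
    have h2 := congrArg (starRingEnd ℂ) h1
    simpa [inner_conj_symm] using h2
  ext g
  exact congrArg (fun L : H →ₗ[ℂ] H => L g) h

open Classical in
/-- The operator `S_φ = ∫ φ dS` (and `0` if there is no such bounded operator). -/
def integral (S : ProjectionValuedMeasure Ω H) (φ : Ω → ℂ) : H →L[ℂ] H :=
  if h : ∃ A, S.HasIntegral φ A then h.choose else 0

theorem HasIntegral.integral_eq {S : ProjectionValuedMeasure Ω H} {φ : Ω → ℂ} {A : H →L[ℂ] H}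
    (hA : S.HasIntegral φ A) : S.integral φ = A := by
  have h : ∃ A, S.HasIntegral φ A := ⟨A, hA⟩
  rw [integral, dif_pos h]
  exact h.choose_spec.unique hA

end ProjectionValuedMeasure

/-- The circle, parameterized by `θ ∈ [-π, π)`, with its Borel sigma-algebra. -/
abbrev Angle : Type := Set.Ico (-Real.pi) Real.pi

/-- `S` is the spectral measure of the unitary operator `U`:
`U ^ k = ∫ exp (i k θ) dS(θ)` for every integer `k`. -/
def IsSpectralMeasure (S : ProjectionValuedMeasure Angle H) (U : H ≃ₗᵢ[ℂ] H) : Prop :=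
  ∀ k : ℤ, S.HasIntegral (fun θ => Complex.exp (Complex.I * (k : ℂ) * ((θ : ℝ) : ℂ)))
    ((U ^ k : H ≃ₗᵢ[ℂ] H).toContinuousLinearEquiv : H →L[ℂ] H)

end PVM

/-! ### Measure-preserving automorphisms and the Koopman operator -/

section Koopman

variable {α : Type*} [MeasurableSpace α]

/-- An invertible transformation `T` with `μ(B) = μ(T(B)) = μ(T⁻¹(B))` for all measurable `B`. -/
structure IsMeasurePreservingAutomorphism (T : Equiv.Perm α) (μ : Measure α) : Prop where
  measurePreserving : MeasurePreserving T μ μ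
  measurePreserving_symm : MeasurePreserving T.symm μ μ

/-- The Koopman operator `g ↦ g ∘ T` on `L²(μ)`, as a unitary operator. -/
def koopman {T : Equiv.Perm α} {μ : Measure α} (hT : IsMeasurePreservingAutomorphism T μ) :
    Lp ℂ 2 μ ≃ₗᵢ[ℂ] Lp ℂ 2 μ :=
  LinearIsometryEquiv.ofSurjective
    (Lp.compMeasurePreservingₗᵢ ℂ T hT.measurePreserving)
    (by
      intro g
      refine ⟨Lp.compMeasurePreserving T.symm hT.measurePreserving_symm g, ?_⟩
      change Lp.compMeasurePreserving T hT.measurePreserving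
        (Lp.compMeasurePreserving T.symm hT.measurePreserving_symm g) = g
      apply Lp.ext
      have h1 := Lp.coeFn_compMeasurePreserving
        (Lp.compMeasurePreserving T.symm hT.measurePreserving_symm g) hT.measurePreserving
      have h2 := hT.measurePreserving.quasiMeasurePreserving.ae_eq_comp
        (Lp.coeFn_compMeasurePreserving g hT.measurePreserving_symm)
      refine h1.trans (h2.trans ?_)
      refine Filter.Eventually.of_forall fun x => ?_
      simp)

end Koopman

/-! ### Partitions into cells of equal measure -/

section Partition

variable {α : Type*} [MetricSpace α] [MeasurableSpace α]

/-- A partition of `α` into `q` compact connected cells of equal measure. Cells may overlap; as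
`μ` is finite, the cells cover `α` and each has measure `μ(α) / q`, all overlaps are `μ`-null. -/
structure EqualPartition (μ : Measure α) where
  /-- the number of cells -/
  q : ℕ
  /-- the cells -/
  cell : Fin q → Set α
  isCompact_cell : ∀ j, IsCompact (cell j)
  isConnected_cell : ∀ j, IsConnected (cell j)
  measure_cell : ∀ j, μ (cell j) = μ Set.univ / (q : ℝ≥0∞)
  iUnion_cell : ⋃ j, cell j = Set.univ

/-- The partitions are successive refinements, the number of cells is strictly increasing, and the
diameters of the cells are bounded by a positive monotone sequence tending to zero. -/
structure IsRefiningSequence {μ : Measure α} (P : ℕ → EqualPartition μ) : Prop where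
  strictMono_q : StrictMono fun n => (P n).q
  diam_le : ∃ l : ℕ → ℝ, (∀ n, 0 < l n) ∧ Antitone l ∧ Tendsto l atTop (𝓝 0) ∧
    ∀ n j, Metric.diam ((P n).cell j) ≤ l n
  refines : ∀ m n, m < n → ∀ j : Fin (P m).q, ∃ s : Set (Fin (P n).q),
    (P m).cell j = ⋃ i ∈ s, (P n).cell i

namespace EqualPartition

variable {μ : Measure α}

/-- For a permutation `σ` of the (indices of the) cells, the union of the `σ`-images of all cells
that meet `A`. For `σ = T_n ^ l` this is the set `T_n ^ l (A_n)`. -/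
def image (P : EqualPartition μ) (σ : Equiv.Perm (Fin P.q)) (A : Set α) : Set α :=
  ⋃ j ∈ {j : Fin P.q | (P.cell j ∩ A).Nonempty}, P.cell (σ j)

variable [BorelSpace α] [IsFiniteMeasure μ]

/-- The indicator function of the `j`-th cell, as an element of `L²(μ)`. -/
def cellIndicator (P : EqualPartition μ) (j : Fin P.q) : Lp ℂ 2 μ :=
  indicatorConstLp 2 (P.isCompact_cell j).measurableSet (measure_ne_top μ _) (1 : ℂ)

/-- The space of linear combinations of the indicator functions of the cells. -/
def stepSpace (P : EqualPartition μ) : Submodule ℂ (Lp ℂ 2 μ) :=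
  Submodule.span ℂ (Set.range P.cellIndicator)

/-- The mean value `q / μ(α) * ∫_{p_j} g dμ` of `g` on the `j`-th cell. For a linear combination
`g` of the indicator functions of the cells this is the `j`-th coefficient of `g`. -/
def cellMean (P : EqualPartition μ) (g : Lp ℂ 2 μ) (j : Fin P.q) : ℂ :=
  ((P.q : ℂ) / (μ.real Set.univ : ℂ)) * ∫ x in P.cell j, g x ∂μ

/-- The averaging operation `W_n`, sending `g` to `∑ j, g_j χ_{p_j}` with `g_j` the mean value of
`g` on the cell `p_j`. -/
def average (P : EqualPartition μ) (g : Lp ℂ 2 μ) : P.stepSpace :=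
  ⟨∑ j, P.cellMean g j • P.cellIndicator j,
    Submodule.sum_mem _ fun j _ => Submodule.smul_mem _ _ (Submodule.subset_span ⟨j, rfl⟩)⟩

/-- The discrete Koopman operator of a permutation `σ` of the cells:
`∑ j, c_j χ_{p_j} ↦ ∑ j, c_j χ_{σ⁻¹(p_j)}`. -/
def discreteKoopman (P : EqualPartition μ) (σ : Equiv.Perm (Fin P.q)) (g : P.stepSpace) :
    P.stepSpace :=
  ⟨∑ j, P.cellMean (g : Lp ℂ 2 μ) j • P.cellIndicator (σ.symm j),
    Submodule.sum_mem _ fun j _ =>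
      Submodule.smul_mem _ _ (Submodule.subset_span ⟨σ.symm j, rfl⟩)⟩

/-- A spectral decomposition of the discrete Koopman operator: an orthonormal basis of
eigenvectors `v_k`, with eigenvalues `exp (i θ_k)`, `θ_k ∈ [-π, π)`. -/
structure EigenDecomposition (P : EqualPartition μ) (σ : Equiv.Perm (Fin P.q)) where
  /-- the angles `θ_k` -/
  angle : Fin P.q → Angle
  /-- the eigenvectors `v_k` -/
  basis : OrthonormalBasis (Fin P.q) ℂ P.stepSpace
  eigen : ∀ k, P.discreteKoopman σ (basis k) =
    Complex.exp (Complex.I * ((angle k : ℝ) : ℂ)) • basis k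

/-- `∑ k, φ(θ_k) S_n(θ_k) h`, where `S_n(θ_k) h = v_k ⟨v_k, h⟩` is the rank-one projector on the
`k`-th eigenvector. -/
def EigenDecomposition.integral {P : EqualPartition μ} {σ : Equiv.Perm (Fin P.q)}
    (d : P.EigenDecomposition σ) (φ : Angle → ℂ) (h : P.stepSpace) : P.stepSpace :=
  ∑ k, φ (d.angle k) • (inner ℂ (d.basis k) h • d.basis k)

end EqualPartition

/-- The permutations `σ n` of the cells of `P n` periodically approximate `T`: for every `k` and
every compact `A`, the sum over `-k ≤ l ≤ k` of the Hausdorff distances between `T ^ l (A)` and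
`T_n ^ l (A_n)` tends to zero. -/
def PeriodicallyApproximates {μ : Measure α} (T : Equiv.Perm α) (P : ℕ → EqualPartition μ)
    (σ : ∀ n, Equiv.Perm (Fin (P n).q)) : Prop :=
  ∀ k : ℕ, ∀ A : Set α, IsCompact A →
    Tendsto (fun n => ∑ l ∈ Finset.Icc (-(k : ℤ)) (k : ℤ),
      Metric.hausdorffDist ((T ^ l : Equiv.Perm α) '' A) ((P n).image (σ n ^ l) A))
      atTop (𝓝 0)

end Partition

end KoopmanSpectra

end

/-! Both functional calculi are linear in the function and bounded by its supremum norm, uniformly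
in `n`. A continuous periodic function is a uniform limit of trigonometric polynomials, so for a
fixed `g` it suffices to treat the characters `exp(ikθ)`. There the claim is the strong convergence
of powers: `U_n^k g_n` tends to `U^k g` for every integer `k`.

Averaging is the orthogonal projection onto step functions and the Koopman operators are unitary, so
the errors are again uniformly bounded in `n`, and `g` may be taken to be the indicator of a
nonempty compact set `A`. Then `U^k` produces the indicator of `T^(-k)(A)`, and `U_n^k` applied to
the indicator of `A_n` produces that of `T_n^(-k)(A_n)`. Hausdorff convergence places the latter set
in shrinking neighbourhoods of the former, whose measures decrease to `μ(A)`. Because `T_n` permutes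
cells of equal mass and `A ⊆ A_n`, its measure never falls below `μ(A)`. Hence the symmetric
difference tends to zero in measure, and the indicators converge in `L²`. This is
`tendsto_measure_symmDiff_of_hausdorffDist`, which feeds `tendsto_stepKoopman_zpow`.

Existence of a spectral measure is the spectral theorem. The continuous functional calculus
represents `C(circle)`; Riesz-Markov-Kakutani gives a measure for each vector; and `L¹`
approximation extends the representation to indicators of Borel sets. The discrete operators have
finite order, so they are diagonalizable, with orthogonal eigenspaces. -/

noncomputable section

namespace KoopmanSpectra

/-! ### Extending a representation of `C(K)` to Borel sets. -/

section SpectralTheorem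

variable {H : Type*} [NormedAddCommGroup H] [InnerProductSpace ℂ H] [CompleteSpace H]

theorem inner_star_mul_self_apply (A : H →L[ℂ] H) (g : H) :
    inner ℂ g ((star A * A) g) = ((‖A g‖ ^ 2 : ℝ) : ℂ) := by
  rw [ContinuousLinearMap.star_eq_adjoint, mul_apply_eq_comp,
    ContinuousLinearMap.adjoint_inner_right, inner_self_eq_norm_sq_to_K]
  simp

variable {K : Type*} [TopologicalSpace K]

/-- A real continuous function, viewed as a complex one. -/
def complexify (f : C(K, ℝ)) : C(K, ℂ) := ⟨fun x => (f x : ℂ), by fun_prop⟩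

@[simp]
theorem complexify_apply (f : C(K, ℝ)) (x : K) : complexify f x = (f x : ℂ) := rfl

theorem star_complexify (f : C(K, ℝ)) : star (complexify f) = complexify f := by
  ext x; simp

theorem complexify_mul (f g : C(K, ℝ)) : complexify (f * g) = complexify f * complexify g := by
  ext x; simp

theorem isSelfAdjoint_map_complexify (Φ : C(K, ℂ) →⋆ₐ[ℂ] (H →L[ℂ] H)) (f : C(K, ℝ)) :
    IsSelfAdjoint (Φ (complexify f)) := by
  rw [IsSelfAdjoint, ← map_star, star_complexify]

theorem inner_map_complexify_left (Φ : C(K, ℂ) →⋆ₐ[ℂ] (H →L[ℂ] H)) (f : C(K, ℝ)) (g h : H) :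
    inner ℂ (Φ (complexify f) g) h = inner ℂ g (Φ (complexify f) h) :=
  (isSelfAdjoint_map_complexify Φ f).isSymmetric g h

theorem ofReal_re_inner_map_complexify (Φ : C(K, ℂ) →⋆ₐ[ℂ] (H →L[ℂ] H)) (f : C(K, ℝ)) (g : H) :
    (((inner ℂ g (Φ (complexify f) g)).re : ℝ) : ℂ) = inner ℂ g (Φ (complexify f) g) := by
  rw [← Complex.conj_eq_iff_re, inner_conj_symm, inner_map_complexify_left]

theorem re_inner_map_complexify_nonneg (Φ : C(K, ℂ) →⋆ₐ[ℂ] (H →L[ℂ] H)) {f : C(K, ℝ)}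
    (hf : ∀ x, 0 ≤ f x) (g : H) : 0 ≤ (inner ℂ g (Φ (complexify f) g)).re := by
  -- With `f = s²` and `s` real, the quadratic form of `Φ(f)` at `g` is `‖Φ(s) g‖²`.
  let s : C(K, ℝ) := ⟨fun x => Real.sqrt (f x), by fun_prop⟩
  have hs : complexify f = star (complexify s) * complexify s := by
    rw [star_complexify, ← complexify_mul]
    congr 1
    ext x
    exact (Real.mul_self_sqrt (hf x)).symm
  rw [hs, map_mul, map_star, inner_star_mul_self_apply, Complex.ofReal_re]
  positivity

variable [CompactSpace K]

theorem norm_map_complexify_apply_le (Φ : C(K, ℂ) →⋆ₐ[ℂ] (H →L[ℂ] H)) {f : C(K, ℝ)}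
    (hf : ∀ x, f x ∈ Set.Icc (0 : ℝ) 1) (g : H) : ‖Φ (complexify f) g‖ ≤ ‖g‖ := by
  have h1 : ‖complexify f‖ ≤ 1 := by
    rw [ContinuousMap.norm_le _ zero_le_one]
    intro x
    simpa [abs_of_nonneg (hf x).1] using (hf x).2
  calc ‖Φ (complexify f) g‖ ≤ ‖Φ (complexify f)‖ * ‖g‖ := ContinuousLinearMap.le_opNorm _ _
    _ ≤ 1 * ‖g‖ := by
      gcongr
      exact (NonUnitalStarAlgHom.norm_apply_le Φ _).trans h1
    _ = ‖g‖ := one_mul _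

variable [MeasurableSpace K] [BorelSpace K]

theorem integrable_continuousMap {F : Type*} [NormedAddCommGroup F] (ν : Measure K)
    [IsFiniteMeasure ν] (f : C(K, F)) : Integrable f ν :=
  (map_continuous f).integrable_of_hasCompactSupport (HasCompactSupport.of_compactSpace _)

theorem integrable_abs_sub_indicator (ν : Measure K) [IsFiniteMeasure ν] {D : Set K}
    (hD : MeasurableSet D) (f : C(K, ℝ)) :
    Integrable (fun x => |f x - D.indicator 1 x|) ν := by
  have h1 : Integrable f ν := integrable_continuousMap ν f
  have h2 : Integrable (D.indicator (1 : K → ℝ)) ν := (integrable_const (1 : ℝ)).indicator hD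
  exact (h1.sub h2).abs

/-- The continuous functions `f n`, with values in `[0, 1]`, converge to the indicator function
of `D` in `L¹(ν)`. -/
def ApproximatesSet (ν : Measure K) (D : Set K) (f : ℕ → C(K, ℝ)) : Prop :=
  (∀ n x, f n x ∈ Set.Icc (0 : ℝ) 1) ∧
    Tendsto (fun n => ∫ x, |f n x - D.indicator 1 x| ∂ν) atTop (𝓝 0)

/-- This lets one sequence, chosen for a sum of vector measures, serve several vectors at once. -/
theorem ApproximatesSet.mono {μ ν : Measure K} [IsFiniteMeasure ν] (h : μ ≤ ν) {D : Set K}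
    (hD : MeasurableSet D) {f : ℕ → C(K, ℝ)} (hf : ApproximatesSet ν D f) :
    ApproximatesSet μ D f :=
  ⟨hf.1, squeeze_zero (fun _ => integral_nonneg fun _ => abs_nonneg _)
    (fun n => integral_mono_measure h (Eventually.of_forall fun _ => abs_nonneg _)
      (integrable_abs_sub_indicator ν hD (f n))) hf.2⟩

/-- On `D` the error is `1 - f² = (1 - f)(1 + f) ≤ 2(1 - f)`, and off `D` it is `f² ≤ f`. It is used
to show that the limiting operators are idempotent. -/
theorem ApproximatesSet.sq {ν : Measure K} [IsFiniteMeasure ν] {D : Set K}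
    (hD : MeasurableSet D) {f : ℕ → C(K, ℝ)} (hf : ApproximatesSet ν D f) :
    ApproximatesSet ν D fun n => f n * f n := by
  refine ⟨fun n x => ⟨mul_self_nonneg _, mul_le_one₀ (hf.1 n x).2 (hf.1 n x).1 (hf.1 n x).2⟩, ?_⟩
  have h2 := hf.2.const_mul 2
  rw [mul_zero] at h2
  refine squeeze_zero (fun n => integral_nonneg fun x => abs_nonneg _) (fun n => ?_) h2
  rw [← integral_const_mul]
  refine integral_mono (integrable_abs_sub_indicator ν hD _)
    ((integrable_abs_sub_indicator ν hD _).const_mul _) fun x => ?_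
  have hx := hf.1 n x
  by_cases hxD : x ∈ D
  · simp only [ContinuousMap.mul_apply, Set.indicator_of_mem hxD, Pi.one_apply]
    rw [abs_of_nonpos (by nlinarith [hx.1, hx.2]), abs_of_nonpos (by linarith [hx.2])]
    nlinarith [hx.1, hx.2]
  · simp only [ContinuousMap.mul_apply, Set.indicator_of_notMem hxD, sub_zero]
    rw [abs_of_nonneg (mul_self_nonneg _), abs_of_nonneg hx.1]
    nlinarith [hx.1, hx.2]

variable [T2Space K]

/-- The Riesz-Markov-Kakutani theorem for a representation of `C(K)`. -/
theorem exists_measure_integral_eq_inner (Φ : C(K, ℂ) →⋆ₐ[ℂ] (H →L[ℂ] H)) (g : H) :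
    ∃ ν : Measure K, IsFiniteMeasure ν ∧ ∀ f : C(K, ℂ), ∫ x, f x ∂ν = inner ℂ g (Φ f g) := by
  let Λ₀ : CompactlySupportedContinuousMap K ℝ →ₗ[ℝ] ℝ :=
    { toFun := fun f => (inner ℂ g (Φ (complexify f) g)).re
      map_add' := fun f₁ f₂ => by
        have : complexify (f₁ + f₂ : CompactlySupportedContinuousMap K ℝ) =
            complexify (f₁ : C(K, ℝ)) + complexify (f₂ : C(K, ℝ)) := by ext x; simp
        rw [this, map_add]
        simp
      map_smul' := fun c f => by
        have : complexify (c • f : CompactlySupportedContinuousMap K ℝ) =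
            (c : ℂ) • complexify (f : C(K, ℝ)) := by ext x; simp
        rw [this, map_smul]
        simp }
  let Λ : CompactlySupportedContinuousMap K ℝ →ₚ[ℝ] ℝ :=
    PositiveLinearMap.mk₀ Λ₀ fun f hf => re_inner_map_complexify_nonneg Φ (fun x => hf x) g
  have key : ∀ f : C(K, ℝ), ∫ x, ((f x : ℝ) : ℂ) ∂(RealRMK.rieszMeasure Λ) =
      inner ℂ g (Φ (complexify f) g) := by
    intro f
    let f' : CompactlySupportedContinuousMap K ℝ := ⟨f, HasCompactSupport.of_compactSpace _⟩
    rw [integral_complex_ofReal, ← ofReal_re_inner_map_complexify]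
    congr 1
    exact RealRMK.integral_rieszMeasure Λ f'
  refine ⟨RealRMK.rieszMeasure Λ, inferInstance, fun f => ?_⟩
  let fr : C(K, ℝ) := ⟨fun x => (f x).re, by fun_prop⟩
  let fi : C(K, ℝ) := ⟨fun x => (f x).im, by fun_prop⟩
  have hf : f = complexify fr + Complex.I • complexify fi := by
    ext x
    simp [fr, fi, mul_comm Complex.I, Complex.re_add_im]
  have h1 : ∀ f : C(K, ℂ), Integrable f (RealRMK.rieszMeasure Λ) := integrable_continuousMap _
  calc ∫ x, f x ∂(RealRMK.rieszMeasure Λ)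
      = ∫ x, (complexify fr x + Complex.I * complexify fi x) ∂(RealRMK.rieszMeasure Λ) := by
        rw [hf]; rfl
    _ = _ := by
        rw [integral_add (h1 _) ((h1 _).const_mul _), integral_const_mul]
        simp only [complexify_apply]
        rw [key, key]
        conv_rhs => rw [hf]
        simp

/-- The measure representing `f ↦ ⟨g, Φ(f) g⟩`. -/
def vectorMeasure (Φ : C(K, ℂ) →⋆ₐ[ℂ] (H →L[ℂ] H)) (g : H) : Measure K :=
  (exists_measure_integral_eq_inner Φ g).choose

instance (Φ : C(K, ℂ) →⋆ₐ[ℂ] (H →L[ℂ] H)) (g : H) : IsFiniteMeasure (vectorMeasure Φ g) :=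
  (exists_measure_integral_eq_inner Φ g).choose_spec.1

theorem integral_vectorMeasure (Φ : C(K, ℂ) →⋆ₐ[ℂ] (H →L[ℂ] H)) (g : H) (f : C(K, ℂ)) :
    ∫ x, f x ∂(vectorMeasure Φ g) = inner ℂ g (Φ f g) :=
  (exists_measure_integral_eq_inner Φ g).choose_spec.2 f

theorem integral_ofReal_vectorMeasure (Φ : C(K, ℂ) →⋆ₐ[ℂ] (H →L[ℂ] H)) (g : H) (f : C(K, ℝ)) :
    ((∫ x, f x ∂(vectorMeasure Φ g) : ℝ) : ℂ) = inner ℂ g (Φ (complexify f) g) := by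
  rw [← integral_vectorMeasure, ← integral_complex_ofReal]; rfl

theorem norm_sq_map_apply (Φ : C(K, ℂ) →⋆ₐ[ℂ] (H →L[ℂ] H)) (g : H) (f : C(K, ℝ)) :
    ‖Φ (complexify f) g‖ ^ 2 = ∫ x, f x ^ 2 ∂(vectorMeasure Φ g) := by
  have h := inner_star_mul_self_apply (Φ (complexify f)) g
  rw [← map_star, ← map_mul, star_complexify, ← complexify_mul,
    ← integral_ofReal_vectorMeasure] at h
  have h' := Complex.ofReal_injective h
  rw [← h']
  simp [pow_two]

theorem vectorMeasure_real_univ (Φ : C(K, ℂ) →⋆ₐ[ℂ] (H →L[ℂ] H)) (g : H) :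
    (vectorMeasure Φ g).real Set.univ = ‖g‖ ^ 2 := by
  have h := norm_sq_map_apply Φ g 1
  have h1 : complexify (1 : C(K, ℝ)) = 1 := by ext; simp
  rw [h1] at h
  simpa using h.symm

/-- By regularity `D` lies between a closed and an open set of nearly equal measure; a Urysohn
function for the pair differs from the indicator only in the gap. -/
theorem exists_approximatesSet [TopologicalSpace.PseudoMetrizableSpace K] (ν : Measure K)
    [IsFiniteMeasure ν] {D : Set K} (hD : MeasurableSet D) :
    ∃ f : ℕ → C(K, ℝ), ApproximatesSet ν D f := by
  have key : ∀ n : ℕ, ∃ f : C(K, ℝ), (∀ x, f x ∈ Set.Icc (0 : ℝ) 1) ∧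
      ∫ x, |f x - D.indicator 1 x| ∂ν ≤ 1 / ((n : ℝ) + 1) := by
    intro n
    have hε : ENNReal.ofReal (1 / ((n : ℝ) + 1) / 2) ≠ 0 := by
      rw [Ne, ENNReal.ofReal_eq_zero, not_le]; positivity
    obtain ⟨U, hDU, hU, -, hUD⟩ := hD.exists_isOpen_sdiff_lt (measure_ne_top ν D) hε
    obtain ⟨F, hFD, hF, hDF⟩ := hD.exists_isClosed_sdiff_lt (measure_ne_top ν D) hε
    obtain ⟨f, hf0, hf1, hf⟩ := exists_continuous_zero_one_of_isClosed hU.isClosed_compl hF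
      (Set.disjoint_left.2 fun x hx hxF => hx (hDU (hFD hxF)))
    refine ⟨f, hf, ?_⟩
    have hm : MeasurableSet ((U \ D) ∪ (D \ F)) :=
      (hU.measurableSet.diff hD).union (hD.diff hF.measurableSet)
    calc ∫ x, |f x - D.indicator 1 x| ∂ν
        ≤ ∫ x, ((U \ D) ∪ (D \ F)).indicator 1 x ∂ν := by
          refine integral_mono (integrable_abs_sub_indicator ν hD f)
            ((integrable_const (1 : ℝ)).indicator hm) fun x => ?_
          have hx := hf x
          by_cases hxD : x ∈ D
          · by_cases hxF : x ∈ F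
            · have h1 := hf1 hxF
              simp only [Pi.one_apply] at h1
              simp only [Set.indicator_of_mem hxD, h1, Pi.one_apply, sub_self, abs_zero]
              exact Set.indicator_nonneg (fun _ _ => zero_le_one) _
            · rw [Set.indicator_of_mem (s := (U \ D) ∪ (D \ F)) (Or.inr ⟨hxD, hxF⟩),
                Set.indicator_of_mem hxD, Pi.one_apply,
                abs_of_nonpos (by linarith [hx.2])]
              linarith [hx.1]
          · by_cases hxU : x ∈ U
            · rw [Set.indicator_of_mem (s := (U \ D) ∪ (D \ F)) (Or.inl ⟨hxU, hxD⟩),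
                Set.indicator_of_notMem hxD, sub_zero, abs_of_nonneg hx.1]
              exact hx.2
            · have h0 := hf0 hxU
              simp only [Pi.zero_apply] at h0
              simp only [Set.indicator_of_notMem hxD, h0, sub_self, abs_zero]
              exact Set.indicator_nonneg (fun _ _ => zero_le_one) _
      _ = ν.real ((U \ D) ∪ (D \ F)) := integral_indicator_one hm
      _ ≤ ν.real (U \ D) + ν.real (D \ F) := measureReal_union_le _ _
      _ ≤ 1 / ((n : ℝ) + 1) / 2 + 1 / ((n : ℝ) + 1) / 2 := by
          refine add_le_add ?_ ?_
          · exact ENNReal.toReal_le_of_le_ofReal (by positivity) hUD.le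
          · exact ENNReal.toReal_le_of_le_ofReal (by positivity) hDF.le
      _ = 1 / ((n : ℝ) + 1) := by ring
  choose f hf1 hf2 using key
  exact ⟨f, hf1, squeeze_zero (fun n => integral_nonneg fun x => abs_nonneg _) hf2
    tendsto_one_div_add_atTop_nhds_zero_nat⟩

/-- The left side is `∫ (a - b)²` against the vector measure, and `(a - b)² ≤ |a - b|` because both
functions take values in `[0, 1]`. The triangle inequality through the indicator finishes. Thus `L¹`
approximation controls convergence in `H`. -/
theorem norm_sq_map_sub_le (Φ : C(K, ℂ) →⋆ₐ[ℂ] (H →L[ℂ] H)) (g : H) {D : Set K}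
    (hD : MeasurableSet D) {a b : C(K, ℝ)} (ha : ∀ x, a x ∈ Set.Icc (0 : ℝ) 1)
    (hb : ∀ x, b x ∈ Set.Icc (0 : ℝ) 1) :
    ‖Φ (complexify a) g - Φ (complexify b) g‖ ^ 2 ≤
      ∫ x, |a x - D.indicator 1 x| ∂(vectorMeasure Φ g) +
        ∫ x, |b x - D.indicator 1 x| ∂(vectorMeasure Φ g) := by
  have h1 : Φ (complexify a) g - Φ (complexify b) g = Φ (complexify (a - b)) g := by
    have : complexify (a - b) = complexify a - complexify b := by ext x; simp
    rw [this, map_sub, sub_apply]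
  rw [h1, norm_sq_map_apply, ← integral_add (integrable_abs_sub_indicator _ hD _)
    (integrable_abs_sub_indicator _ hD _)]
  refine integral_mono ?_ ((integrable_abs_sub_indicator _ hD _).add
    (integrable_abs_sub_indicator _ hD _)) fun x => ?_
  · exact integrable_continuousMap (vectorMeasure Φ g) ((a - b) ^ 2)
  · simp only [ContinuousMap.sub_apply]
    have h2 : |a x - b x| ≤ 1 := abs_le.2 ⟨by linarith [(ha x).1, (hb x).2],
      by linarith [(ha x).2, (hb x).1]⟩
    have h3 := abs_sub_le (a x) (D.indicator 1 x) (b x)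
    rw [abs_sub_comm (D.indicator 1 x)] at h3
    calc (a x - b x) ^ 2 = |a x - b x| * |a x - b x| := by rw [← sq, sq_abs]
      _ ≤ |a x - b x| * 1 := by gcongr
      _ ≤ _ := by rw [mul_one]; exact h3

variable [TopologicalSpace.PseudoMetrizableSpace K]

/-- One approximating sequence gives a Cauchy sequence, and any other stays close to it.
Independence of the sequence is what makes the limit linear in `g` later on. -/
theorem exists_tendsto_of_approximatesSet (Φ : C(K, ℂ) →⋆ₐ[ℂ] (H →L[ℂ] H)) {D : Set K}
    (hD : MeasurableSet D) (g : H) :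
    ∃ y : H, ∀ f, ApproximatesSet (vectorMeasure Φ g) D f →
      Tendsto (fun n => Φ (complexify (f n)) g) atTop (𝓝 y) := by
  obtain ⟨f₀, hf₀⟩ := exists_approximatesSet (vectorMeasure Φ g) hD
  have hc : CauchySeq fun n => Φ (complexify (f₀ n)) g := by
    rw [Metric.cauchySeq_iff]
    intro ε hε
    have h1 := (hf₀.2.eventually (gt_mem_nhds (show (0 : ℝ) < ε ^ 2 / 2 by positivity)))
    obtain ⟨N, hN⟩ := eventually_atTop.1 h1
    refine ⟨N, fun m hm n hn => ?_⟩
    rw [dist_eq_norm]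
    refine lt_of_pow_lt_pow_left₀ 2 hε.le ?_
    have := norm_sq_map_sub_le Φ g hD (hf₀.1 m) (hf₀.1 n)
    linarith [hN m hm, hN n hn]
  obtain ⟨y, hy⟩ := cauchySeq_tendsto_of_complete hc
  refine ⟨y, fun f hf => ?_⟩
  have h0 : Tendsto (fun n => ‖Φ (complexify (f n)) g - Φ (complexify (f₀ n)) g‖ ^ 2)
      atTop (𝓝 0) :=
    squeeze_zero (fun n => by positivity)
      (fun n => norm_sq_map_sub_le Φ g hD (hf.1 n) (hf₀.1 n)) (by simpa using hf.2.add hf₀.2)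
  have h1 : Tendsto (fun n => ‖Φ (complexify (f n)) g - Φ (complexify (f₀ n)) g‖) atTop (𝓝 0) := by
    have := h0.sqrt
    simpa [Real.sqrt_sq] using this
  have h2 := (tendsto_zero_iff_norm_tendsto_zero.2 h1).add hy
  simpa using h2

/-- A representation of `C(K)` extends to indicator functions of Borel sets. -/
theorem exists_isStarProjection_inner_eq (Φ : C(K, ℂ) →⋆ₐ[ℂ] (H →L[ℂ] H)) {D : Set K}
    (hD : MeasurableSet D) :
    ∃ A : H →L[ℂ] H, IsStarProjection A ∧
      ∀ g, inner ℂ g (A g) = (((vectorMeasure Φ g).real D : ℝ) : ℂ) := by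
  choose y hy using exists_tendsto_of_approximatesSet Φ hD
  have hadd : ∀ g h, y (g + h) = y g + y h := by
    -- A sequence adapted to the sum of the three vector measures is adapted to each, so additivity
    -- passes to the limit.
    intro g h
    obtain ⟨f, hf⟩ := exists_approximatesSet
      (vectorMeasure Φ g + vectorMeasure Φ h + vectorMeasure Φ (g + h)) hD
    have h1 := hy g f (hf.mono (by rw [add_assoc]; exact Measure.le_add_right le_rfl) hD)
    have h2 := hy h f (hf.mono
      (Measure.le_add_right (Measure.le_add_left le_rfl)) hD)
    have h3 := hy (g + h) f (hf.mono (Measure.le_add_left le_rfl) hD)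
    refine tendsto_nhds_unique h3 ((h1.add h2).congr fun n => ?_)
    rw [map_add]
  have hsmul : ∀ (c : ℂ) g, y (c • g) = c • y g := by
    intro c g
    obtain ⟨f, hf⟩ := exists_approximatesSet
      (vectorMeasure Φ g + vectorMeasure Φ (c • g)) hD
    have h1 := hy g f (hf.mono (Measure.le_add_right le_rfl) hD)
    have h3 := hy (c • g) f (hf.mono (Measure.le_add_left le_rfl) hD)
    refine tendsto_nhds_unique h3 ((h1.const_smul c).congr fun n => ?_)
    rw [map_smul]
  have hnorm : ∀ g, ‖y g‖ ≤ 1 * ‖g‖ := by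
    intro g
    obtain ⟨f, hf⟩ := exists_approximatesSet (vectorMeasure Φ g) hD
    rw [one_mul]
    exact le_of_tendsto (hy g f hf).norm
      (Eventually.of_forall fun n => norm_map_complexify_apply_le Φ (hf.1 n) g)
  let A : H →L[ℂ] H := LinearMap.mkContinuous ⟨⟨y, hadd⟩, hsmul⟩ 1 hnorm
  refine ⟨A, ⟨?_, ?_⟩, ?_⟩
  · ext g
    change y (y g) = y g
    obtain ⟨f, hf⟩ := exists_approximatesSet (vectorMeasure Φ g + vectorMeasure Φ (y g)) hD
    have hf1 := hf.mono (Measure.le_add_right le_rfl) hD (μ := vectorMeasure Φ g)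
    have hf2 := hf.mono (Measure.le_add_left le_rfl) hD (μ := vectorMeasure Φ (y g))
    have h1 := hy g _ (hf1.sq hD)
    have h2 := hy g _ hf1
    have h3 := hy (y g) _ hf2
    -- Since `Φ(f_n)` is a contraction, `Φ(f_n)² g` and `Φ(f_n)(y g)` have the same limit. The first
    -- tends to `y g`, as `f_n²` also approximates `D`; the second tends to `y (y g)`.
    have h4 : Tendsto (fun n => Φ (complexify (f n)) (Φ (complexify (f n)) g - y g)) atTop
        (𝓝 0) := by
      refine squeeze_zero_norm (fun n => norm_map_complexify_apply_le Φ (hf.1 n) _) ?_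
      have := (h2.sub_const (y g)).norm
      simpa using this
    have h5 := h1.sub h4
    rw [sub_zero] at h5
    refine tendsto_nhds_unique h3 (h5.congr fun n => ?_)
    rw [complexify_mul, map_mul, map_sub, mul_apply_eq_comp]
    abel
  · rw [ContinuousLinearMap.isSelfAdjoint_iff_isSymmetric]
    intro g h
    change inner ℂ (y g) h = inner ℂ g (y h)
    obtain ⟨f, hf⟩ := exists_approximatesSet (vectorMeasure Φ g + vectorMeasure Φ h) hD
    have h1 := hy g f (hf.mono (Measure.le_add_right le_rfl) hD)
    have h2 := hy h f (hf.mono (Measure.le_add_left le_rfl) hD)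
    refine tendsto_nhds_unique (h1.inner tendsto_const_nhds)
      ((Tendsto.inner tendsto_const_nhds h2).congr fun n => ?_)
    rw [inner_map_complexify_left]
  · intro g
    obtain ⟨f, hf⟩ := exists_approximatesSet (vectorMeasure Φ g) hD
    have h1 := Tendsto.inner (𝕜 := ℂ) (tendsto_const_nhds (x := g)) (hy g f hf)
    have h2 : Tendsto (fun n => ∫ x, f n x ∂(vectorMeasure Φ g)) atTop
        (𝓝 ((vectorMeasure Φ g).real D)) := by
      rw [tendsto_iff_norm_sub_tendsto_zero]
      refine squeeze_zero (fun n => norm_nonneg _) (fun n => ?_) hf.2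
      have h3 : Integrable (D.indicator (1 : K → ℝ)) (vectorMeasure Φ g) :=
        (integrable_const (1 : ℝ)).indicator hD
      rw [← integral_indicator_one hD, ← integral_sub (integrable_continuousMap _ _) h3]
      exact norm_integral_le_integral_norm _
    refine tendsto_nhds_unique h1 (((Complex.continuous_ofReal.tendsto _).comp h2).congr
      fun n => ?_)
    exact integral_ofReal_vectorMeasure Φ g (f n)

end SpectralTheorem

/-! ### Projection-valued measures and the spectral measure of a unitary operator. -/

section SpectralMeasure

variable {H : Type*} [NormedAddCommGroup H] [InnerProductSpace ℂ H]

theorem ext_inner_self {A B : H →L[ℂ] H} (h : ∀ g, inner ℂ g (A g) = inner ℂ g (B g)) : A = B := by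
  have h' : (A : H →ₗ[ℂ] H) = (B : H →ₗ[ℂ] H) := by
    rw [← ext_inner_map]
    intro g
    simpa [inner_conj_symm] using congrArg (starRingEnd ℂ) (h g)
  ext g
  exact congrArg (fun L : H →ₗ[ℂ] H => L g) h'

/-- The bounded operator underlying a power of a unitary operator. -/
abbrev zpowCLM (U : H ≃ₗᵢ[ℂ] H) (k : ℤ) : H →L[ℂ] H :=
  ((U ^ k : H ≃ₗᵢ[ℂ] H).toContinuousLinearEquiv : H →L[ℂ] H)

theorem zpowCLM_add (U : H ≃ₗᵢ[ℂ] H) (k l : ℤ) :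
    zpowCLM U (k + l) = zpowCLM U k * zpowCLM U l := by
  ext g
  rw [zpowCLM, zpow_add]
  rfl

variable [CompleteSpace H]

/-- Expanding the square of the sum gives `PQ + QP = 0`. Multiplying by `P` on the left and on the
right shows that `PQ` and `QP` both equal `-PQP`, so they coincide and `2PQ = 0`. Applied to
disjoint sets, this makes the ranges of their projectors orthogonal. -/
theorem mul_eq_zero_of_isIdempotentElem_add {P Q : H →L[ℂ] H} (hP : IsIdempotentElem P)
    (hQ : IsIdempotentElem Q) (hPQ : IsIdempotentElem (P + Q)) : P * Q = 0 := by
  have h1 : P * Q + Q * P = 0 := by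
    have h := hPQ.eq
    simp only [add_mul, mul_add, hP.eq, hQ.eq] at h
    have : P + Q * P + (P * Q + Q) = (P + Q) + (P * Q + Q * P) := by abel
    rw [this] at h
    simpa using h
  have h2 : P * Q + P * Q * P = 0 := by
    calc P * Q + P * Q * P = P * (P * Q + Q * P) := by rw [mul_add, ← mul_assoc, ← mul_assoc, hP.eq]
      _ = 0 := by rw [h1, mul_zero]
  have h3 : P * Q * P + Q * P = 0 := by
    calc P * Q * P + Q * P = (P * Q + Q * P) * P := by
          rw [add_mul, mul_assoc Q P P, hP.eq]
      _ = 0 := by rw [h1, zero_mul]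
  have h4 : P * Q = Q * P := by
    rw [eq_neg_of_add_eq_zero_left h2, eq_neg_of_add_eq_zero_right h3]
  rw [← h4, ← two_smul ℂ] at h1
  exact (smul_eq_zero.1 h1).resolve_left two_ne_zero

theorem IsStarProjection.inner_apply_self {P : H →L[ℂ] H} (hP : IsStarProjection P) (g : H) :
    inner ℂ g (P g) = ((‖P g‖ ^ 2 : ℝ) : ℂ) := by
  rw [← inner_star_mul_self_apply, hP.isSelfAdjoint.star_eq, hP.isIdempotentElem.eq]

/-- A family of orthogonal projectors whose quadratic forms are finite measures is a
projection-valued measure. -/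
theorem exists_projectionValuedMeasure {Ω : Type*} [MeasurableSpace Ω] (ν : H → Measure Ω)
    [∀ g, IsFiniteMeasure (ν g)] (huniv : ∀ g, (ν g).real Set.univ = ‖g‖ ^ 2)
    (hex : ∀ D, MeasurableSet D → ∃ A : H →L[ℂ] H, IsStarProjection A ∧
      ∀ g, inner ℂ g (A g) = (((ν g).real D : ℝ) : ℂ)) :
    ∃ S : ProjectionValuedMeasure Ω H, ∀ g, S.scalarMeasure g = ν g := by
  classical
  choose! p hproj hp using hex
  have hnorm : ∀ D, MeasurableSet D → ∀ g, ‖p D g‖ ^ 2 = (ν g).real D := by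
    intro D hD g
    have h := hp D hD g
    rw [IsStarProjection.inner_apply_self (hproj D hD)] at h
    exact Complex.ofReal_injective h
  have hunion : ∀ D₁ D₂, MeasurableSet D₁ → MeasurableSet D₂ → Disjoint D₁ D₂ →
      p (D₁ ∪ D₂) = p D₁ + p D₂ := by
    intro D₁ D₂ h₁ h₂ hd
    refine ext_inner_self fun g => ?_
    rw [add_apply, inner_add_right, hp _ h₁, hp _ h₂, hp _ (h₁.union h₂),
      measureReal_union hd h₂]
    push_cast
    rfl
  have hempty : p ∅ = 0 := ext_inner_self fun g => by
    rw [hp _ MeasurableSet.empty]; simp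
  let S : ProjectionValuedMeasure Ω H :=
    { proj := p
      isStarProjection := hproj
      proj_empty := hempty
      proj_univ := ext_inner_self fun g => by
        rw [hp _ MeasurableSet.univ, huniv, one_apply_eq_self,
          inner_self_eq_norm_sq_to_K]
        simp
      inner_eq_zero := by
        intro D₁ D₂ h₁ h₂ hd g h
        have h0 : p D₁ * p D₂ = 0 := mul_eq_zero_of_isIdempotentElem_add
          (hproj _ h₁).isIdempotentElem (hproj _ h₂).isIdempotentElem
          (by rw [← hunion _ _ h₁ h₂ hd]; exact (hproj _ (h₁.union h₂)).isIdempotentElem)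
        have h1 : inner ℂ (p D₁ g) (p D₂ h) = inner ℂ g (p D₁ (p D₂ h)) :=
          (hproj _ h₁).isSelfAdjoint.isSymmetric g (p D₂ h)
        rw [h1, ← mul_apply_eq_comp, h0]
        simp
      tendsto_sum := by
        intro D hD hdisj g
        have hpart : ∀ m : ℕ, (∑ k ∈ Finset.range m, p (D k) g) + p (⋃ k ≥ m, D k) g =
            p (⋃ k, D k) g := by
          intro m
          induction m with
          | zero => simp
          | succ m ih =>
            have hm : MeasurableSet (⋃ k ≥ m + 1, D k) :=
              MeasurableSet.iUnion fun k => MeasurableSet.iUnion fun _ => hD k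
            have hu : (⋃ k ≥ m, D k) = D m ∪ ⋃ k ≥ m + 1, D k := by
              ext x
              simp only [Set.mem_iUnion, Set.mem_union, exists_prop]
              constructor
              · rintro ⟨k, hk, hx⟩
                rcases eq_or_lt_of_le hk with rfl | hk
                · exact Or.inl hx
                · exact Or.inr ⟨k, hk, hx⟩
              · rintro (hx | ⟨k, hk, hx⟩)
                · exact ⟨m, le_rfl, hx⟩
                · exact ⟨k, (Nat.le_succ m).trans hk, hx⟩
            have hd : Disjoint (D m) (⋃ k ≥ m + 1, D k) := by
              simp only [Set.disjoint_iUnion_right]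
              intro k hk
              exact hdisj (by omega)
            rw [← ih, hu, hunion _ _ (hD m) hm hd, Finset.sum_range_succ, add_apply, add_assoc]
        -- The squared norm of the tail is the `ν g`-measure of the tail union, which tends to zero
        -- by continuity from above.
        have htail : Tendsto (fun m => p (⋃ k ≥ m, D k) g) atTop (𝓝 0) := by
          rw [tendsto_zero_iff_norm_tendsto_zero]
          have h1 := tendsto_measure_biUnion_Ici_zero_of_pairwise_disjoint (μ := ν g)
            (fun k => (hD k).nullMeasurableSet) hdisj
          have h2 := ((ENNReal.tendsto_toReal ENNReal.zero_ne_top).comp h1).sqrt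
          simp only [ENNReal.toReal_zero, Real.sqrt_zero] at h2
          refine h2.congr fun m => ?_
          have h3 := hnorm (⋃ k ≥ m, D k)
            (MeasurableSet.iUnion fun k => MeasurableSet.iUnion fun _ => hD k) g
          rw [Measure.real] at h3
          simp only [Function.comp_apply]
          rw [← h3, Real.sqrt_sq (norm_nonneg _)]
        have h := (tendsto_const_nhds (x := p (⋃ k, D k) g)).sub htail
        rw [sub_zero] at h
        refine h.congr fun m => ?_
        rw [← hpart m, add_sub_cancel_right] }
  refine ⟨S, fun g => ?_⟩
  ext D hD
  rw [ProjectionValuedMeasure.scalarMeasure, Measure.ofMeasurable_apply _ hD]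
  change ENNReal.ofReal (inner ℂ g (p D g)).re = _
  rw [hp D hD, Complex.ofReal_re, ofReal_measureReal]

instance (S : ProjectionValuedMeasure Angle H) (g : H) : IsFiniteMeasure (S.scalarMeasure g) := by
  refine ⟨?_⟩
  rw [ProjectionValuedMeasure.scalarMeasure, Measure.ofMeasurable_apply _ MeasurableSet.univ]
  exact ENNReal.ofReal_lt_top

instance fact_two_pi_pos : Fact (0 < 2 * Real.pi) := ⟨Real.two_pi_pos⟩

/-- The continuous functional calculus of a unitary operator, as a representation of the algebra
of continuous functions of the angle. -/
theorem exists_starAlgHom_fourier (U : H ≃ₗᵢ[ℂ] H) :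
    ∃ Ψ : C(AddCircle (2 * Real.pi), ℂ) →⋆ₐ[ℂ] (H →L[ℂ] H),
      ∀ k : ℤ, Ψ (fourier k) = zpowCLM U k := by
  let u : unitary (H →L[ℂ] H) := Unitary.linearIsometryEquiv.symm U
  have hu : (u : H →L[ℂ] H) = zpowCLM U 1 := by ext g; simp [u]
  have hn : IsStarNormal (u : H →L[ℂ] H) := inferInstance
  -- The spectrum of a unitary lies on the unit circle; `s` reads off the angle, so pulling `fourier
  -- 1` back along `s` gives the identity function on the spectrum.
  let s : C(spectrum ℂ (u : H →L[ℂ] H), AddCircle (2 * Real.pi)) :=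
    ⟨fun z => AddCircle.homeomorphCircle'.symm
      ⟨(z : ℂ), by simpa [Submonoid.unitSphere] using spectrum.subset_circle_of_unitary u.2 z.2⟩,
      AddCircle.homeomorphCircle'.symm.continuous.comp (by fun_prop)⟩
  let Ψ := (cfcHom hn (R := ℂ)).comp (ContinuousMap.compStarAlgHom' ℂ ℂ s)
  have h1 : Ψ (fourier 1) = zpowCLM U 1 := by
    rw [← hu]
    conv_rhs => rw [← cfcHom_id hn (R := ℂ)]
    change cfcHom hn _ = _
    congr 1
    ext z
    have h : AddCircle.toCircle (s z) = AddCircle.homeomorphCircle' (s z) := by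
      rw [← AddCircle.homeomorphCircle_apply Real.two_pi_pos.ne']
      generalize s z = x
      induction x using QuotientAddGroup.induction_on with | H x => ?_
      rw [AddCircle.homeomorphCircle_apply, AddCircle.toCircle_apply_mk,
        AddCircle.homeomorphCircle'_apply_mk, div_self Real.two_pi_pos.ne', one_mul]
    change fourier 1 (s z) = (z : ℂ)
    rw [fourier_one, h]
    exact congrArg Subtype.val (AddCircle.homeomorphCircle'.apply_symm_apply _)
  have h0 : Ψ (fourier 0) = zpowCLM U 0 := by
    have : (fourier 0 : C(AddCircle (2 * Real.pi), ℂ)) = 1 := by ext x; simp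
    rw [this, map_one]
    ext g
    simp
    rfl
  have hadd : ∀ k l : ℤ, Ψ (fourier (k + l)) = Ψ (fourier k) * Ψ (fourier l) := by
    intro k l
    rw [← map_mul]
    congr 1
    ext x
    simp
  have hneg : zpowCLM U 1 * zpowCLM U (-1) = 1 := by
    rw [← zpowCLM_add]
    ext g
    simp
    rfl
  refine ⟨Ψ, fun k => ?_⟩
  induction k using Int.induction_on with
  | zero => exact h0
  | succ k ih => rw [hadd, ih, h1, zpowCLM_add]
  | pred k ih =>
    have e1 : Ψ (fourier (-(k : ℤ) - 1)) * zpowCLM U 1 = zpowCLM U (-(k : ℤ) - 1) * zpowCLM U 1 := by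
      rw [← zpowCLM_add, ← h1, ← hadd, sub_add_cancel, ih]
    calc Ψ (fourier (-(k : ℤ) - 1))
        = Ψ (fourier (-(k : ℤ) - 1)) * zpowCLM U 1 * zpowCLM U (-1) := by
          rw [mul_assoc, hneg, mul_one]
      _ = _ := by rw [e1, mul_assoc, hneg, mul_one]

theorem fourier_coe_eq_exp (k : ℤ) (θ : ℝ) :
    fourier k (θ : AddCircle (2 * Real.pi)) = Complex.exp (Complex.I * (k : ℂ) * (θ : ℂ)) := by
  rw [fourier_coe_apply]
  congr 1
  have : (Real.pi : ℂ) ≠ 0 := by exact_mod_cast Real.pi_ne_zero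
  push_cast
  field_simp

/-- Every unitary operator has a spectral measure. -/
theorem exists_isSpectralMeasure (U : H ≃ₗᵢ[ℂ] H) :
    ∃ S : ProjectionValuedMeasure Angle H, IsSpectralMeasure S U := by
  obtain ⟨Ψ, hΨ⟩ := exists_starAlgHom_fourier U
  -- The section of the quotient map with values in `[-π, π)` is discontinuous at the cut but Borel,
  -- which is enough to push the vector measures forward.
  let e : AddCircle (2 * Real.pi) → Angle := fun x =>
    ⟨AddCircle.equivIco (2 * Real.pi) (-Real.pi) x, by
      have h := (AddCircle.equivIco (2 * Real.pi) (-Real.pi) x).2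
      exact ⟨h.1, h.2.trans_eq (by ring)⟩⟩
  have he : Measurable e :=
    (measurable_subtype_coe.comp
      (AddCircle.measurableEquivIco (2 * Real.pi) (-Real.pi)).measurable).subtype_mk
  have hcoe : ∀ x, (((e x : ℝ)) : AddCircle (2 * Real.pi)) = x := fun x => AddCircle.coe_equivIco
  obtain ⟨S, hS⟩ := exists_projectionValuedMeasure (fun g => (vectorMeasure Ψ g).map e)
    (fun g => by
      rw [map_measureReal_apply he MeasurableSet.univ, Set.preimage_univ, vectorMeasure_real_univ])
    (fun D hD => by
      obtain ⟨A, hA, hA'⟩ := exists_isStarProjection_inner_eq Ψ (he hD)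
      exact ⟨A, hA, fun g => by rw [hA', map_measureReal_apply he hD]⟩)
  refine ⟨S, fun k g => ?_⟩
  have hφ : Continuous fun θ : Angle =>
      Complex.exp (Complex.I * (k : ℂ) * ((θ : ℝ) : ℂ)) := by fun_prop
  rw [hS]
  constructor
  · refine Integrable.of_bound hφ.aestronglyMeasurable 1 (Eventually.of_forall fun θ => ?_)
    rw [Complex.norm_exp]
    simp
  · rw [integral_map he.aemeasurable hφ.aestronglyMeasurable]
    simp_rw [← fourier_coe_eq_exp, hcoe]
    rw [integral_vectorMeasure, hΨ]

/-- Density of trigonometric polynomials in the supremum norm, a case of Stone-Weierstrass, is the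
source of every reduction to integer powers. -/
theorem dense_span_fourier :
    Dense (Submodule.span ℂ (Set.range (@fourier (2 * Real.pi))) :
      Set C(AddCircle (2 * Real.pi), ℂ)) := by
  rw [Submodule.dense_iff_topologicalClosure_eq_top]
  exact span_fourier_closure_eq_top

/-- The functional calculus of a spectral measure agrees with the continuous one. -/
theorem IsSpectralMeasure.hasIntegral {S : ProjectionValuedMeasure Angle H} {U : H ≃ₗᵢ[ℂ] H}
    (hS : IsSpectralMeasure S U) {Ψ : C(AddCircle (2 * Real.pi), ℂ) →⋆ₐ[ℂ] (H →L[ℂ] H)}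
    (hΨ : ∀ k : ℤ, Ψ (fourier k) = zpowCLM U k) (F : C(AddCircle (2 * Real.pi), ℂ)) :
    S.HasIntegral (fun θ => F ((θ : ℝ) : AddCircle (2 * Real.pi))) (Ψ F) := by
  intro g
  have hcont : ∀ F : C(AddCircle (2 * Real.pi), ℂ),
      Continuous fun θ : Angle => F ((θ : ℝ) : AddCircle (2 * Real.pi)) := fun F =>
    (map_continuous F).comp ((AddCircle.continuous_mk' _).comp continuous_subtype_val)
  have hint : ∀ F : C(AddCircle (2 * Real.pi), ℂ), Integrable
      (fun θ : Angle => F ((θ : ℝ) : AddCircle (2 * Real.pi))) (S.scalarMeasure g) := fun F =>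
    Integrable.of_bound (hcont F).aestronglyMeasurable ‖F‖
      (Eventually.of_forall fun θ => F.norm_coe_le_norm _)
  refine ⟨hint F, ?_⟩
  let L₁ : C(AddCircle (2 * Real.pi), ℂ) →L[ℂ] ℂ := LinearMap.mkContinuous
    { toFun := fun F => inner ℂ g (Ψ F g)
      map_add' := fun F G => by rw [map_add, add_apply, inner_add_right]
      map_smul' := fun c F => by rw [map_smul, smul_apply, inner_smul_right]; rfl } (‖g‖ * ‖g‖) fun F => by
    calc ‖(inner ℂ g (Ψ F g) : ℂ)‖ ≤ ‖g‖ * ‖Ψ F g‖ := norm_inner_le_norm _ _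
      _ ≤ ‖g‖ * (‖F‖ * ‖g‖) := by
        gcongr
        exact (ContinuousLinearMap.le_opNorm _ _).trans
          (by gcongr; exact NonUnitalStarAlgHom.norm_apply_le Ψ F)
      _ = ‖g‖ * ‖g‖ * ‖F‖ := by ring
  let L₂ : C(AddCircle (2 * Real.pi), ℂ) →L[ℂ] ℂ := LinearMap.mkContinuous
    { toFun := fun F => ∫ θ : Angle, F ((θ : ℝ) : AddCircle (2 * Real.pi)) ∂(S.scalarMeasure g)
      map_add' := fun F G => integral_add (hint F) (hint G)
      map_smul' := fun c F => integral_const_mul c _ } ((S.scalarMeasure g).real Set.univ) fun F => by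
    refine le_of_le_of_eq ?_ (mul_comm _ _)
    exact norm_integral_le_of_norm_le_const (Eventually.of_forall fun θ => F.norm_coe_le_norm _)
  -- Two bounded functionals on `C(circle)` that agree on characters are equal; on characters this
  -- is the definition of a spectral measure.
  have h : L₁ = L₂ := by
    refine ContinuousLinearMap.ext_on dense_span_fourier ?_
    rintro _ ⟨k, rfl⟩
    change inner ℂ g (Ψ (fourier k) g) = ∫ θ : Angle, fourier k _ ∂(S.scalarMeasure g)
    rw [hΨ, (hS k g).2]
    simp_rw [fourier_coe_eq_exp]
  exact congrArg (fun L : C(AddCircle (2 * Real.pi), ℂ) →L[ℂ] ℂ => L F) h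

end SpectralMeasure

/-! ### Diagonalization of unitary operators of finite order. -/

section FiniteOrder

variable {V : Type*} [NormedAddCommGroup V] [InnerProductSpace ℂ V]

theorem exists_angle_exp_eq {c : ℂ} (hc : ‖c‖ = 1) :
    ∃ θ : Angle, Complex.exp (Complex.I * ((θ : ℝ) : ℂ)) = c := by
  have hexp : Complex.exp (Complex.I * (Complex.arg c : ℂ)) = c := by
    have h := Complex.norm_mul_exp_arg_mul_I c
    rw [hc] at h
    simpa [mul_comm] using h
  -- `Complex.arg` takes values in `(-π, π]`, so the endpoint `π` has to be moved to `-π`.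
  by_cases h : Complex.arg c = Real.pi
  · refine ⟨⟨-Real.pi, le_rfl, by linarith [Real.pi_pos]⟩, ?_⟩
    rw [← hexp, h]
    push_cast
    rw [mul_neg, Complex.exp_neg, mul_comm, Complex.exp_pi_mul_I]
    norm_num
  · exact ⟨⟨Complex.arg c, (Complex.neg_pi_lt_arg c).le,
      lt_of_le_of_ne (Complex.arg_le_pi c) h⟩, hexp⟩

theorem norm_eq_one_of_eigenvector (U : V ≃ₗᵢ[ℂ] V) {c : ℂ} {v : V} (hv : v ≠ 0)
    (h : U v = c • v) : ‖c‖ = 1 := by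
  have h1 := congrArg norm h
  rw [U.norm_map, norm_smul] at h1
  exact (mul_eq_right₀ (norm_ne_zero_iff.2 hv)).1 h1.symm

theorem zpow_apply_eigenvector (U : V ≃ₗᵢ[ℂ] V) {θ : ℝ} {v : V}
    (h : U v = Complex.exp (Complex.I * (θ : ℂ)) • v) (k : ℤ) :
    (U ^ k) v = Complex.exp (Complex.I * (k : ℂ) * (θ : ℂ)) • v := by
  induction k using Int.induction_on with
  | zero => simp
  | succ k ih =>
    rw [zpow_add_one, LinearIsometryEquiv.coe_mul, Function.comp_apply, h, map_smul, ih, smul_smul, ← Complex.exp_add]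
    congr 2
    push_cast
    ring
  | pred k ih =>
    have h1 : U⁻¹ v = Complex.exp (-(Complex.I * (θ : ℂ))) • v := by
      apply U.injective
      rw [map_smul, h, smul_smul, ← Complex.exp_add, neg_add_cancel, Complex.exp_zero, one_smul]
      exact U.apply_symm_apply v
    rw [zpow_sub_one, LinearIsometryEquiv.coe_mul, Function.comp_apply, h1, map_smul, ih, smul_smul, ← Complex.exp_add]
    congr 2
    push_cast
    ring

variable [FiniteDimensional ℂ V]

/-- A unitary operator of finite order on a finite-dimensional space has an orthonormal basis of
eigenvectors. -/
theorem exists_orthonormalBasis_eigenvector (U : V ≃ₗᵢ[ℂ] V) {N : ℕ} (hN : 0 < N)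
    (hU : U ^ N = 1) {n : ℕ} (hn : Module.finrank ℂ V = n) :
    ∃ (θ : Fin n → Angle) (b : OrthonormalBasis (Fin n) ℂ V), ∀ k,
      U (b k) = Complex.exp (Complex.I * ((θ k : ℝ) : ℂ)) • b k := by
  classical
  let f : Module.End ℂ V := (U.toLinearEquiv : V →ₗ[ℂ] V)
  have hf : ∀ v, f v = U v := fun v => rfl
  have hpow : f ^ N = 1 := by
    have : ∀ (k : ℕ) v, (f ^ k) v = (U ^ k) v := by
      intro k
      induction k with
      | zero => intro v; rfl
      | succ k ih => intro v; rw [pow_succ, pow_succ, Module.End.mul_apply, ih, hf]; rfl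
    ext v
    rw [this, hU]
    rfl
  -- The operator is annihilated by `X ^ N - 1`, which is squarefree over `ℂ`. Generalized
  -- eigenspaces, which span, are therefore eigenspaces.
  have hss : f.IsSemisimple := by
    refine Module.End.isSemisimple_of_squarefree_aeval_eq_zero
      (p := (Polynomial.X ^ N - 1 : Polynomial ℂ)) ?_ (by simp [hpow])
    refine Polynomial.Separable.squarefree ?_
    exact Polynomial.X_pow_sub_one_separable_iff.2 (by exact_mod_cast hN.ne')
  have htop : ⨆ c : ℂ, f.eigenspace c = ⊤ := by
    rw [← Module.End.iSup_maxGenEigenspace_eq_top f]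
    congr 1
    ext1 c
    exact (hss.isFinitelySemisimple.maxGenEigenspace_eq_eigenspace c).symm
  have htop' : ⨆ c : Module.End.Eigenvalues f, f.eigenspace c = ⊤ := by
    rw [← htop]
    refine le_antisymm (iSup_le fun c => le_iSup (fun c : ℂ => f.eigenspace c) c)
      (iSup_le fun c => ?_)
    by_cases hc : f.HasEigenvalue c
    · exact le_iSup (fun c : Module.End.Eigenvalues f => f.eigenspace c) ⟨c, hc⟩
    · rw [Module.End.hasEigenvalue_iff, not_not] at hc
      rw [hc]
      exact bot_le
  have horth : OrthogonalFamily ℂ (fun c : Module.End.Eigenvalues f => f.eigenspace c)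
      fun c => (f.eigenspace c).subtypeₗᵢ := by
    rintro ⟨a, ha⟩ ⟨b, hb⟩ hab ⟨v, hv⟩ ⟨w, hw⟩
    have hv' : U v = a • v := Module.End.mem_eigenspace_iff.1 hv
    have hw' : U w = b • w := Module.End.mem_eigenspace_iff.1 hw
    change inner ℂ v w = 0
    by_contra hne
    have hv0 : v ≠ 0 := by rintro rfl; simp at hne
    -- If `v` and `w` were not orthogonal, unitarity would give `conj a * b = 1`, and `|a| = 1`
    -- would then force `a = b`.
    have h1 := U.inner_map_map v w
    rw [hv', hw', inner_smul_left, inner_smul_right, ← mul_assoc] at h1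
    have h2 : (starRingEnd ℂ) a * b = 1 := (mul_eq_right₀ hne).1 h1
    have h3 : a * (starRingEnd ℂ) a = 1 := by
      rw [Complex.mul_conj', norm_eq_one_of_eigenvector U hv0 hv']; simp
    refine hab (Subtype.ext ?_)
    calc a = a * ((starRingEnd ℂ) a * b) := by rw [h2, mul_one]
      _ = b := by rw [← mul_assoc, h3, one_mul]
  have hint : DirectSum.IsInternal fun c : Module.End.Eigenvalues f => f.eigenspace c := by
    rw [horth.isInternal_iff, htop', Submodule.top_orthogonal_eq_bot]
  let b := hint.subordinateOrthonormalBasis hn horth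
  have hb : ∀ k, ∃ θ : Angle, U (b k) = Complex.exp (Complex.I * ((θ : ℝ) : ℂ)) • b k := by
    intro k
    have h1 : U (b k) = _ := Module.End.mem_eigenspace_iff.1
      (hint.subordinateOrthonormalBasis_subordinate hn k horth)
    obtain ⟨θ, hθ⟩ := exists_angle_exp_eq
      (norm_eq_one_of_eigenvector U (b.orthonormal.ne_zero k) h1)
    exact ⟨θ, by rw [hθ]; exact h1⟩
  choose θ hθ using hb
  exact ⟨θ, b, hθ⟩

end FiniteOrder

/-! ### Step functions and the discrete Koopman operator. -/

namespace EqualPartition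

variable {α : Type*} [MetricSpace α] [MeasurableSpace α] {μ : Measure α}

theorem q_pos (P : EqualPartition μ) (hμ : μ ≠ 0) : 0 < P.q := by
  have : NeZero μ := ⟨hμ⟩
  obtain ⟨x⟩ : Nonempty α := μ.nonempty_of_neZero
  have hx : x ∈ ⋃ j, P.cell j := by rw [P.iUnion_cell]; trivial
  obtain ⟨j, -⟩ := Set.mem_iUnion.1 hx
  exact j.pos

/-- The measure of a cell. -/
def mass (P : EqualPartition μ) : ℝ := μ.real Set.univ / P.q

theorem measureReal_cell (P : EqualPartition μ) (j : Fin P.q) : μ.real (P.cell j) = P.mass := by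
  rw [Measure.real, P.measure_cell, ENNReal.toReal_div]
  simp [mass, Measure.real]

theorem mass_pos [IsFiniteMeasure μ] (P : EqualPartition μ) (hμ : μ ≠ 0) : 0 < P.mass := by
  have : NeZero μ := ⟨hμ⟩
  have h1 : (0 : ℝ) < P.q := by exact_mod_cast P.q_pos hμ
  exact div_pos measureReal_univ_pos h1

variable [BorelSpace α]

theorem measurableSet_cell (P : EqualPartition μ) (j : Fin P.q) : MeasurableSet (P.cell j) :=
  (P.isCompact_cell j).measurableSet

variable [IsFiniteMeasure μ]

/-- The set `p_i \ p_j` together with the `q - 1` cells other than `p_i` covers the space, which has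
measure `q` times the mass of a cell. So `p_i \ p_j` already has the full mass of `p_i`. -/
theorem measureReal_inter_cell (P : EqualPartition μ) {i j : Fin P.q} (hij : i ≠ j) :
    μ.real (P.cell i ∩ P.cell j) = 0 := by
  have hq : (0 : ℝ) < P.q := by exact_mod_cast i.pos
  have hcover : (Set.univ : Set α) ⊆
      (P.cell i \ P.cell j) ∪ ⋃ k ∈ Finset.univ.erase i, P.cell k := by
    intro x _
    have hx : x ∈ ⋃ j, P.cell j := by rw [P.iUnion_cell]; trivial
    obtain ⟨k, hk⟩ := Set.mem_iUnion.1 hx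
    by_cases hxj : x ∈ P.cell j
    · exact Or.inr (Set.mem_biUnion (x := j) (by simp [hij.symm]) hxj)
    · by_cases hki : k = i
      · exact Or.inl ⟨hki ▸ hk, hxj⟩
      · exact Or.inr (Set.mem_biUnion (x := k) (by simp [hki]) hk)
  have h1 : μ.real Set.univ ≤ μ.real (P.cell i \ P.cell j) + ((P.q : ℝ) - 1) * P.mass := by
    calc μ.real Set.univ
        ≤ μ.real ((P.cell i \ P.cell j) ∪ ⋃ k ∈ Finset.univ.erase i, P.cell k) :=
          measureReal_mono hcover
      _ ≤ μ.real (P.cell i \ P.cell j) + ∑ k ∈ Finset.univ.erase i, μ.real (P.cell k) :=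
          (measureReal_union_le _ _).trans (by gcongr; exact measureReal_biUnion_finset_le _ _)
      _ = _ := by
          simp only [measureReal_cell, Finset.sum_const, nsmul_eq_mul]
          rw [Finset.card_erase_of_mem (Finset.mem_univ i), Finset.card_univ, Fintype.card_fin,
            Nat.cast_sub i.pos, Nat.cast_one]
  have h2 : μ.real Set.univ = P.q * P.mass := by rw [mass]; field_simp
  have h3 := measureReal_inter_add_sdiff (μ := μ) (s := P.cell i) (P.measurableSet_cell j)
  rw [measureReal_cell] at h3
  have h4 : 0 ≤ μ.real (P.cell i ∩ P.cell j) := measureReal_nonneg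
  nlinarith

theorem inner_cellIndicator (P : EqualPartition μ) (i j : Fin P.q) :
    inner ℂ (P.cellIndicator i) (P.cellIndicator j) = if i = j then (P.mass : ℂ) else 0 := by
  rw [cellIndicator, cellIndicator, L2.inner_indicatorConstLp_indicatorConstLp]
  split_ifs with h
  · subst h
    simp [measureReal_cell]
  · simp [measureReal_inter_cell P h]

theorem cellMean_eq_inner (P : EqualPartition μ) (g : Lp ℂ 2 μ) (j : Fin P.q) :
    P.cellMean g j = (P.mass : ℂ)⁻¹ * inner ℂ (P.cellIndicator j) g := by
  rw [cellMean, cellIndicator, L2.inner_indicatorConstLp_one, mass]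
  push_cast
  rw [inv_div]

theorem cellIndicator_mem (P : EqualPartition μ) (j : Fin P.q) :
    P.cellIndicator j ∈ P.stepSpace :=
  Submodule.subset_span ⟨j, rfl⟩

/-- The normalized indicator functions of the cells. -/
def unitCell (P : EqualPartition μ) (j : Fin P.q) : P.stepSpace :=
  ((Real.sqrt P.mass : ℝ) : ℂ)⁻¹ • ⟨P.cellIndicator j, P.cellIndicator_mem j⟩

theorem coe_unitCell (P : EqualPartition μ) (j : Fin P.q) :
    (P.unitCell j : Lp ℂ 2 μ) = ((Real.sqrt P.mass : ℝ) : ℂ)⁻¹ • P.cellIndicator j := rfl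

theorem orthonormal_unitCell (P : EqualPartition μ) (hμ : μ ≠ 0) :
    Orthonormal ℂ P.unitCell := by
  have hm := P.mass_pos hμ
  rw [orthonormal_iff_ite]
  intro i j
  rw [Submodule.coe_inner, coe_unitCell, coe_unitCell, inner_smul_left, inner_smul_right,
    inner_cellIndicator]
  split_ifs
  · rw [map_inv₀, Complex.conj_ofReal]
    norm_cast
    rw [← mul_assoc, ← mul_inv, Real.mul_self_sqrt hm.le, inv_mul_cancel₀ hm.ne']
  · simp

theorem sqrt_mass_smul_unitCell (P : EqualPartition μ) (hμ : μ ≠ 0) (j : Fin P.q) :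
    P.cellIndicator j = ((Real.sqrt P.mass : ℝ) : ℂ) • (P.unitCell j : Lp ℂ 2 μ) := by
  have hm : ((Real.sqrt P.mass : ℝ) : ℂ) ≠ 0 := by
    exact_mod_cast (Real.sqrt_pos.2 (P.mass_pos hμ)).ne'
  rw [coe_unitCell, smul_smul, mul_inv_cancel₀ hm, one_smul]

/-- The orthonormal basis of normalized indicator functions of the cells. -/
def cellBasis (P : EqualPartition μ) (hμ : μ ≠ 0) : OrthonormalBasis (Fin P.q) ℂ P.stepSpace :=
  OrthonormalBasis.mk (P.orthonormal_unitCell hμ) (by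
    rintro ⟨x, hx⟩ -
    have h1 : P.stepSpace ≤
        (Submodule.span ℂ (Set.range P.unitCell)).map P.stepSpace.subtype := by
      refine Submodule.span_le.2 ?_
      rintro _ ⟨j, rfl⟩
      refine ⟨((Real.sqrt P.mass : ℝ) : ℂ) • P.unitCell j,
        Submodule.smul_mem _ _ (Submodule.subset_span ⟨j, rfl⟩), ?_⟩
      rw [map_smul]
      exact (P.sqrt_mass_smul_unitCell hμ j).symm
    obtain ⟨y, hy, hyx⟩ := h1 hx
    have : y = ⟨x, hx⟩ := Subtype.ext hyx
    rwa [← this])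

@[simp]
theorem cellBasis_apply (P : EqualPartition μ) (hμ : μ ≠ 0) (j : Fin P.q) :
    P.cellBasis hμ j = P.unitCell j := by
  simp [cellBasis]

/-- The factor `1 / mass` in the mean value splits into two square roots, one normalizing each
indicator. Separate indices cover both averaging (`j = i`) and the discrete Koopman operator (`j =
σ.symm i`). -/
theorem cellMean_smul_cellIndicator (P : EqualPartition μ) (hμ : μ ≠ 0) (g : Lp ℂ 2 μ)
    (i j : Fin P.q) :
    P.cellMean g i • P.cellIndicator j =
      (inner ℂ (P.unitCell i : Lp ℂ 2 μ) g • P.unitCell j : P.stepSpace) := by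
  have hm := P.mass_pos hμ
  have hs : ((Real.sqrt P.mass : ℝ) : ℂ) ≠ 0 := by
    exact_mod_cast (Real.sqrt_pos.2 hm).ne'
  have hm' : (P.mass : ℂ) = ((Real.sqrt P.mass : ℝ) : ℂ) * ((Real.sqrt P.mass : ℝ) : ℂ) := by
    rw [← Complex.ofReal_mul, Real.mul_self_sqrt hm.le]
  rw [cellMean_eq_inner, sqrt_mass_smul_unitCell P hμ i, sqrt_mass_smul_unitCell P hμ j,
    inner_smul_left, Complex.conj_ofReal, smul_smul, hm', Submodule.coe_smul]
  congr 1
  field_simp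

instance (P : EqualPartition μ) : FiniteDimensional ℂ P.stepSpace :=
  FiniteDimensional.span_of_finite ℂ (Set.finite_range _)

/-- Averaging is the orthogonal projection onto the space of step functions. -/
theorem average_eq_orthogonalProjection (P : EqualPartition μ) (hμ : μ ≠ 0) (g : Lp ℂ 2 μ) :
    P.average g = P.stepSpace.orthogonalProjectionOnto g := by
  rw [(P.cellBasis hμ).orthogonalProjectionOnto_eq_sum_rankOne]
  apply Subtype.ext
  simp only [sum_apply, InnerProductSpace.rankOne_apply, average, cellMean_smul_cellIndicator P hμ, cellBasis_apply, Submodule.coe_sum]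

/-- The discrete Koopman operator as a unitary operator. -/
def stepKoopman (P : EqualPartition μ) (hμ : μ ≠ 0) (σ : Equiv.Perm (Fin P.q)) :
    P.stepSpace ≃ₗᵢ[ℂ] P.stepSpace :=
  (P.cellBasis hμ).equiv (P.cellBasis hμ) σ.symm

theorem stepKoopman_unitCell (P : EqualPartition μ) (hμ : μ ≠ 0) (σ : Equiv.Perm (Fin P.q))
    (j : Fin P.q) : P.stepKoopman hμ σ (P.unitCell j) = P.unitCell (σ.symm j) := by
  rw [← cellBasis_apply P hμ, stepKoopman, OrthonormalBasis.equiv_apply_basis, cellBasis_apply]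

theorem discreteKoopman_eq_stepKoopman (P : EqualPartition μ) (hμ : μ ≠ 0)
    (σ : Equiv.Perm (Fin P.q)) (g : P.stepSpace) :
    P.discreteKoopman σ g = P.stepKoopman hμ σ g := by
  conv_rhs => rw [← (P.cellBasis hμ).sum_repr' g]
  rw [map_sum]
  apply Subtype.ext
  simp only [discreteKoopman, cellMean_smul_cellIndicator P hμ, map_smul, cellBasis_apply,
    stepKoopman_unitCell, Submodule.coe_sum]
  rfl

theorem stepKoopman_zpow_unitCell (P : EqualPartition μ) (hμ : μ ≠ 0) (σ : Equiv.Perm (Fin P.q))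
    (k : ℤ) (j : Fin P.q) :
    (P.stepKoopman hμ σ ^ k) (P.unitCell j) = P.unitCell ((σ ^ (-k)) j) := by
  induction k using Int.induction_on generalizing j with
  | zero => simp
  | succ k ih =>
    rw [zpow_add_one, LinearIsometryEquiv.coe_mul, Function.comp_apply, stepKoopman_unitCell, ih, neg_add,
      zpow_add, zpow_neg_one]
    rfl
  | pred k ih =>
    have h1 : (P.stepKoopman hμ σ)⁻¹ (P.unitCell j) = P.unitCell (σ j) := by
      apply (P.stepKoopman hμ σ).injective
      rw [stepKoopman_unitCell, Equiv.symm_apply_apply]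
      exact (P.stepKoopman hμ σ).apply_symm_apply _
    rw [zpow_sub_one, LinearIsometryEquiv.coe_mul, Function.comp_apply, h1, ih, neg_sub, sub_neg_eq_add, add_comm,
      neg_neg, zpow_add_one]
    rfl

theorem nonempty_eigenDecomposition (P : EqualPartition μ) (hμ : μ ≠ 0)
    (σ : Equiv.Perm (Fin P.q)) : Nonempty (P.EigenDecomposition σ) := by
  -- A permutation of finitely many cells has finite order, and the operator inherits it.
  have hU : P.stepKoopman hμ σ ^ orderOf σ = 1 := by
    have h1 : ∀ j, (P.stepKoopman hμ σ ^ orderOf σ) (P.unitCell j) = P.unitCell j := by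
      intro j
      rw [← zpow_natCast, stepKoopman_zpow_unitCell, zpow_neg, zpow_natCast, pow_orderOf_eq_one]
      simp
    ext1 g
    conv_lhs => rw [← (P.cellBasis hμ).sum_repr' g]
    conv_rhs => rw [← (P.cellBasis hμ).sum_repr' g]
    simp only [map_sum, map_smul, cellBasis_apply, h1]
    rfl
  have hn : Module.finrank ℂ P.stepSpace = P.q := by
    rw [Module.finrank_eq_card_basis (P.cellBasis hμ).toBasis, Fintype.card_fin]
  obtain ⟨θ, b, h⟩ := exists_orthonormalBasis_eigenvector (P.stepKoopman hμ σ)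
    (orderOf_pos σ) hU hn
  exact ⟨⟨θ, b, fun k => by rw [discreteKoopman_eq_stepKoopman P hμ, h]⟩⟩

end EqualPartition

/-- A uniformly bounded sequence of linear maps that tends to zero pointwise on a set with dense
span tends to zero pointwise. -/
theorem tendsto_zero_of_dense_span {V W : Type*} [NormedAddCommGroup V] [NormedSpace ℂ V]
    [NormedAddCommGroup W] [NormedSpace ℂ W] (L : ℕ → V →ₗ[ℂ] W) {C : ℝ}
    (hL : ∀ n x, ‖L n x‖ ≤ C * ‖x‖) {s : Set V} (hs : Dense (Submodule.span ℂ s : Set V))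
    (h : ∀ x ∈ s, Tendsto (fun n => L n x) atTop (𝓝 0)) (x : V) :
    Tendsto (fun n => L n x) atTop (𝓝 0) := by
  have hspan : ∀ y ∈ Submodule.span ℂ s, Tendsto (fun n => L n y) atTop (𝓝 0) := by
    intro y hy
    induction hy using Submodule.span_induction with
    | mem y hy => exact h y hy
    | zero => simp
    | add y z _ _ hy hz => simpa using hy.add hz
    | smul c y _ hy => simpa using hy.const_smul c
  have hC : 0 < |C| + 1 := by positivity
  rw [Metric.tendsto_atTop]
  intro ε hε
  obtain ⟨y, hy, hxy⟩ := Metric.mem_closure_iff.1 (hs x) (ε / 2 / (|C| + 1)) (by positivity)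
  obtain ⟨N, hN⟩ := Metric.tendsto_atTop.1 (hspan y hy) (ε / 2) (by positivity)
  refine ⟨N, fun n hn => ?_⟩
  have h1 := hN n hn
  rw [dist_zero_right] at h1 ⊢
  rw [dist_eq_norm] at hxy
  calc ‖L n x‖ = ‖L n (x - y) + L n y‖ := by rw [map_sub, sub_add_cancel]
    _ ≤ ‖L n (x - y)‖ + ‖L n y‖ := norm_add_le _ _
    _ ≤ (|C| + 1) * ‖x - y‖ + ‖L n y‖ := by
      gcongr
      exact (hL n _).trans (by gcongr; linarith [le_abs_self C])
    _ < (|C| + 1) * (ε / 2 / (|C| + 1)) + ε / 2 := by gcongr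
    _ = ε := by field_simp; ring

/-! ### Indicators of compact sets in `L²`. -/

section Indicator

variable {α : Type*} [MeasurableSpace α] {μ : Measure α} [IsFiniteMeasure μ]

/-- The indicator function of a measurable set as an element of `L²(μ)`. -/
abbrev indicatorL2 (μ : Measure α) [IsFiniteMeasure μ] {A : Set α} (hA : MeasurableSet A) :
    Lp ℂ 2 μ :=
  indicatorConstLp 2 hA (measure_ne_top μ A) 1

theorem indicatorL2_congr {A B : Set α} (hA : MeasurableSet A) (hB : MeasurableSet B)
    (h : A = B) : indicatorL2 μ hA = indicatorL2 μ hB := by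
  subst h; rfl

theorem indicatorL2_union {A B : Set α} (hA : MeasurableSet A) (hB : MeasurableSet B)
    (hAB : μ (A ∩ B) = 0) :
    indicatorL2 μ (hA.union hB) = indicatorL2 μ hA + indicatorL2 μ hB := by
  apply Lp.ext
  have hnot : ∀ᵐ x ∂μ, x ∉ A ∩ B := measure_eq_zero_iff_ae_notMem.1 hAB
  filter_upwards [Lp.coeFn_add (indicatorL2 μ hA) (indicatorL2 μ hB), hnot,
    indicatorConstLp_coeFn (p := 2) (hs := hA) (hμs := measure_ne_top μ A) (c := (1 : ℂ)),
    indicatorConstLp_coeFn (p := 2) (hs := hB) (hμs := measure_ne_top μ B) (c := (1 : ℂ)),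
    indicatorConstLp_coeFn (p := 2) (hs := hA.union hB) (hμs := measure_ne_top μ _)
      (c := (1 : ℂ))] with x h1 h2 h3 h4 h5
  rw [h1, Pi.add_apply, h3, h4, h5, Set.indicator_union_of_notMem_inter h2]

theorem indicatorConstLp_eq_smul {A : Set α} (hA : MeasurableSet A) (c : ℂ) :
    indicatorConstLp 2 hA (measure_ne_top μ A) c = c • indicatorL2 μ hA := by
  apply Lp.ext
  filter_upwards [Lp.coeFn_smul c (indicatorL2 μ hA),
    indicatorConstLp_coeFn (p := 2) (hs := hA) (hμs := measure_ne_top μ A) (c := (1 : ℂ)),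
    indicatorConstLp_coeFn (p := 2) (hs := hA) (hμs := measure_ne_top μ A) (c := c)]
    with x h1 h2 h3
  rw [h1, h3, Pi.smul_apply, h2]
  by_cases hx : x ∈ A <;> simp [hx]

/-- Inner regularity approximates a Borel set in measure by compact subsets, and simple functions
are dense. Compact sets are the ones that periodic approximation controls. -/
theorem dense_span_indicatorL2_isCompact [MetricSpace α] [CompactSpace α] [BorelSpace α] :
    Dense (Submodule.span ℂ {g : Lp ℂ 2 μ | ∃ (A : Set α) (hA : IsCompact A),
      g = indicatorL2 μ hA.measurableSet} : Set (Lp ℂ 2 μ)) := by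
  set M := Submodule.span ℂ {g : Lp ℂ 2 μ | ∃ (A : Set α) (hA : IsCompact A),
      g = indicatorL2 μ hA.measurableSet}
  have hind : ∀ (s : Set α) (hs : MeasurableSet s), indicatorL2 μ hs ∈ M.topologicalClosure := by
    intro s hs
    have key : ∀ n : ℕ, ∃ K ⊆ s, IsCompact K ∧ μ (s \ K) < ((n : ℝ≥0∞) + 1)⁻¹ := fun n =>
      hs.exists_isCompact_sdiff_lt (measure_ne_top μ s) (by simp)
    choose K hKs hK hμK using key
    have hlim : Tendsto (fun n => μ (symmDiff (K n) s)) atTop (𝓝 0) := by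
      refine tendsto_of_tendsto_of_tendsto_of_le_of_le tendsto_const_nhds
        ((tendsto_add_atTop_iff_nat 1).2 ENNReal.tendsto_inv_nat_nhds_zero)
        (fun _ => zero_le) (fun n => ?_)
      rw [Set.symmDiff_def, Set.sdiff_eq_empty.2 (hKs n), Set.empty_union]
      simpa using (hμK n).le
    have h := tendsto_indicatorConstLp_set (p := 2) (c := (1 : ℂ)) (hs := hs)
      (hμs := measure_ne_top μ s) (ht := fun n => (hK n).measurableSet)
      (hμt := fun n => measure_ne_top μ (K n)) (by simp) hlim
    exact mem_closure_of_tendsto h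
      (Eventually.of_forall fun n => Submodule.subset_span ⟨K n, hK n, rfl⟩)
  intro g
  change g ∈ M.topologicalClosure
  refine Lp.induction ENNReal.ofNat_ne_top (fun g => g ∈ M.topologicalClosure) ?_ ?_ ?_ g
  · intro c s hs hμs
    rw [Lp.simpleFunc.coe_indicatorConst, indicatorConstLp_eq_smul]
    exact Submodule.smul_mem _ _ (hind _ hs)
  · exact fun _ _ _ _ _ h1 h2 => Submodule.add_mem _ h1 h2
  · exact M.isClosed_topologicalClosure

end Indicator

/-! ### Powers of the Koopman operator on indicators. -/

section KoopmanPowers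

variable {α : Type*} [MeasurableSpace α] {μ : Measure α}

theorem IsMeasurePreservingAutomorphism.zpow {T : Equiv.Perm α}
    (hT : IsMeasurePreservingAutomorphism T μ) (k : ℤ) :
    MeasurePreserving (T ^ k : Equiv.Perm α) μ μ := by
  induction k using Int.induction_on with
  | zero => exact MeasurePreserving.id μ
  | succ k ih => rw [zpow_add_one]; exact ih.comp hT.measurePreserving
  | pred k ih => rw [zpow_sub_one]; exact ih.comp hT.measurePreserving_symm

variable [IsFiniteMeasure μ]

theorem koopman_indicatorL2 {T : Equiv.Perm α} (hT : IsMeasurePreservingAutomorphism T μ)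
    {A : Set α} (hA : MeasurableSet A) :
    koopman hT (indicatorL2 μ hA) = indicatorL2 μ (hT.measurePreserving.measurable hA) :=
  Lp.indicatorConstLp_compMeasurePreserving hA _ _ hT.measurePreserving

theorem koopman_zpow_indicatorL2 {T : Equiv.Perm α} (hT : IsMeasurePreservingAutomorphism T μ)
    (k : ℤ) {A : Set α} (hA : MeasurableSet A) :
    (koopman hT ^ k) (indicatorL2 μ hA) = indicatorL2 μ ((hT.zpow k).measurable hA) := by
  induction k using Int.induction_on generalizing A with
  | zero => rfl
  | succ k ih =>
    rw [zpow_add_one, LinearIsometryEquiv.coe_mul, Function.comp_apply, koopman_indicatorL2, ih]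
    refine indicatorL2_congr _ _ ?_
    rw [add_comm, zpow_one_add, Equiv.Perm.coe_mul, Set.preimage_comp]
  | pred k ih =>
    have h1 : (koopman hT)⁻¹ (indicatorL2 μ hA) =
        indicatorL2 μ (hT.measurePreserving_symm.measurable hA) := by
      apply (koopman hT).injective
      rw [koopman_indicatorL2]
      refine ((koopman hT).apply_symm_apply _).trans (indicatorL2_congr _ _ ?_)
      rw [← Set.preimage_comp]
      simp
    rw [zpow_sub_one, LinearIsometryEquiv.coe_mul, Function.comp_apply, h1, ih]
    refine indicatorL2_congr _ _ ?_
    rw [sub_eq_neg_add, zpow_add, zpow_neg_one, Equiv.Perm.coe_mul, Set.preimage_comp]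
    rfl

end KoopmanPowers

/-! ### From Hausdorff convergence to convergence in measure. -/

section HausdorffConvergence

variable {α : Type*} [MetricSpace α] [CompactSpace α] [MeasurableSpace α] [BorelSpace α]
  {μ : Measure α} [IsFiniteMeasure μ]

/-- Convergence in the Hausdorff distance to a compact set of at most equal measure implies
convergence in measure. -/
theorem tendsto_measure_symmDiff_of_hausdorffDist {K : Set α} (hK : IsCompact K)
    (hKne : K.Nonempty) {B : ℕ → Set α} (hB : ∀ n, MeasurableSet (B n))
    (hBne : ∀ n, (B n).Nonempty) (hle : ∀ n, μ K ≤ μ (B n))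
    (hd : Tendsto (fun n => Metric.hausdorffDist K (B n)) atTop (𝓝 0)) :
    Tendsto (fun n => μ (symmDiff (B n) K)) atTop (𝓝 0) := by
  -- The added term makes the radius positive and strictly larger than the Hausdorff distance, as
  -- open thickenings require.
  let r : ℕ → ℝ := fun n => Metric.hausdorffDist K (B n) + 1 / ((n : ℝ) + 1)
  have hr0 : ∀ n, Metric.hausdorffDist K (B n) < r n := fun n =>
    lt_add_of_pos_right _ (by positivity)
  have hr : Tendsto r atTop (𝓝[>] 0) := by
    refine tendsto_nhdsWithin_iff.2 ⟨?_, Eventually.of_forall fun n =>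
      Metric.hausdorffDist_nonneg.trans_lt (hr0 n)⟩
    simpa only [add_zero] using hd.add (tendsto_one_div_add_atTop_nhds_zero_nat (𝕜 := ℝ))
  have hsub : ∀ n, B n ⊆ Metric.thickening (r n) K := by
    intro n x hx
    rw [Metric.mem_thickening_iff_infDist_lt hKne]
    refine lt_of_le_of_lt ?_ (hr0 n)
    rw [Metric.hausdorffDist_comm]
    exact Metric.infDist_le_hausdorffDist_of_mem hx
      (Metric.hausdorffEDist_ne_top_of_nonempty_of_bounded (hBne n) hKne
        (Metric.isBounded_of_compactSpace) (Metric.isBounded_of_compactSpace))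
  have hthick : Tendsto (fun n => μ.real (Metric.thickening (r n) K)) atTop (𝓝 (μ.real K)) :=
    (ENNReal.tendsto_toReal (measure_ne_top μ K)).comp
      ((tendsto_measure_thickening_of_isClosed ⟨1, one_pos, measure_ne_top μ _⟩
        hK.isClosed).comp hr)
  -- From `μ K ≤ μ (B n)` it follows that `K \ B n` is no larger in measure than `B n \ K`; hence
  -- the factor 2. The larger piece lies in the thickening minus `K`.
  have hbound : ∀ n, μ.real (symmDiff (B n) K) ≤
      2 * (μ.real (Metric.thickening (r n) K) - μ.real K) := by
    intro n
    have hKm := hK.measurableSet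
    have h1 : μ.real (symmDiff (B n) K) = μ.real (B n \ K) + μ.real (K \ B n) :=
      measureReal_union (disjoint_sdiff_sdiff) (hKm.diff (hB n))
    have h2 := measureReal_inter_add_sdiff (μ := μ) (s := B n) hKm
    have h3 := measureReal_inter_add_sdiff (μ := μ) (s := K) (hB n)
    rw [Set.inter_comm] at h3
    have h4 : μ.real K ≤ μ.real (B n) := ENNReal.toReal_mono (measure_ne_top μ _) (hle n)
    have h5 : μ.real (B n \ K) ≤ μ.real (Metric.thickening (r n) K \ K) :=
      measureReal_mono (Set.sdiff_subset_sdiff_left (hsub n))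
    have h6 := measureReal_inter_add_sdiff (μ := μ) (s := Metric.thickening (r n) K) hKm
    rw [Set.inter_eq_self_of_subset_right
      (Metric.self_subset_thickening (Metric.hausdorffDist_nonneg.trans_lt (hr0 n)) K)] at h6
    linarith
  have hlim : Tendsto (fun n => μ.real (symmDiff (B n) K)) atTop (𝓝 0) := by
    refine squeeze_zero (fun _ => measureReal_nonneg) hbound ?_
    simpa using (hthick.sub_const (μ.real K)).const_mul 2
  have h := ENNReal.tendsto_ofReal hlim
  simpa using h

end HausdorffConvergence

/-! ### Unions of permuted cells. -/

namespace EqualPartition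

variable {α : Type*} [MetricSpace α] [MeasurableSpace α] {μ : Measure α}

open Classical in
theorem image_eq_biUnion_filter (P : EqualPartition μ) (σ : Equiv.Perm (Fin P.q)) (A : Set α) :
    P.image σ A =
      ⋃ j ∈ Finset.univ.filter (fun j => (P.cell j ∩ A).Nonempty), P.cell (σ j) := by
  simp [image]

theorem image_nonempty (P : EqualPartition μ) (σ : Equiv.Perm (Fin P.q)) {A : Set α}
    (hA : A.Nonempty) : (P.image σ A).Nonempty := by
  obtain ⟨x, hx⟩ := hA
  have hx' : x ∈ ⋃ j, P.cell j := by rw [P.iUnion_cell]; trivial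
  obtain ⟨j, hj⟩ := Set.mem_iUnion.1 hx'
  obtain ⟨y, hy⟩ := (P.isConnected_cell (σ j)).nonempty
  exact ⟨y, Set.mem_biUnion (x := j) ⟨x, hj, hx⟩ hy⟩

theorem subset_image_one (P : EqualPartition μ) (A : Set α) : A ⊆ P.image 1 A := by
  intro x hx
  have hx' : x ∈ ⋃ j, P.cell j := by rw [P.iUnion_cell]; trivial
  obtain ⟨j, hj⟩ := Set.mem_iUnion.1 hx'
  exact Set.mem_biUnion (x := j) ⟨x, hj, hx⟩ hj

variable [BorelSpace α]

theorem measurableSet_image (P : EqualPartition μ) (σ : Equiv.Perm (Fin P.q)) (A : Set α) :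
    MeasurableSet (P.image σ A) :=
  MeasurableSet.biUnion (Set.to_countable _) fun j _ => P.measurableSet_cell (σ j)

variable [IsFiniteMeasure μ]

theorem measure_inter_cell (P : EqualPartition μ) {i j : Fin P.q} (hij : i ≠ j) :
    μ (P.cell i ∩ P.cell j) = 0 :=
  (measureReal_eq_zero_iff).1 (P.measureReal_inter_cell hij)

open Classical in
-- Overlaps are null and a permutation keeps the number of cells, so the measure is that number
-- times the mass of one cell.
theorem measure_image_eq (P : EqualPartition μ) (σ τ : Equiv.Perm (Fin P.q)) (A : Set α) :
    μ (P.image σ A) = μ (P.image τ A) := by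
  have h : ∀ σ : Equiv.Perm (Fin P.q), μ (P.image σ A) =
      ∑ j ∈ Finset.univ.filter (fun j => (P.cell j ∩ A).Nonempty), μ Set.univ / (P.q : ℝ≥0∞) := by
    intro σ
    rw [image_eq_biUnion_filter, measure_biUnion_finset₀]
    · simp only [P.measure_cell]
    · intro i _ j _ hij
      exact P.measure_inter_cell (σ.injective.ne hij)
    · exact fun j _ => (P.measurableSet_cell (σ j)).nullMeasurableSet
  rw [h, h]

open Classical in
theorem indicatorL2_image (P : EqualPartition μ) (σ : Equiv.Perm (Fin P.q)) (A : Set α) :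
    indicatorL2 μ (P.measurableSet_image σ A) =
      ∑ j ∈ Finset.univ.filter (fun j => (P.cell j ∩ A).Nonempty), P.cellIndicator (σ j) := by
  have key : ∀ (s : Finset (Fin P.q)) (hs : MeasurableSet (⋃ j ∈ s, P.cell (σ j))),
      indicatorL2 μ hs = ∑ j ∈ s, P.cellIndicator (σ j) := by
    intro s
    induction s using Finset.induction_on with
    | empty =>
      intro hs
      rw [Finset.sum_empty, ← indicatorConstLp_empty (c := (1 : ℂ))]
      exact indicatorL2_congr _ _ (by simp)
    | insert i s his ih =>
      intro hs
      have hm : MeasurableSet (⋃ j ∈ s, P.cell (σ j)) :=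
        s.measurableSet_biUnion fun j _ => P.measurableSet_cell (σ j)
      rw [Finset.sum_insert his, ← ih hm]
      have hnull : μ (P.cell (σ i) ∩ ⋃ j ∈ s, P.cell (σ j)) = 0 := by
        rw [Set.inter_iUnion₂]
        refine (measure_biUnion_null_iff s.countable_toSet).2 fun j hj => ?_
        exact P.measure_inter_cell (σ.injective.ne (by rintro rfl; exact his hj))
      rw [cellIndicator, ← indicatorL2_union _ hm hnull]
      exact indicatorL2_congr _ _ (by simp)
  rw [← key _ (by rw [← image_eq_biUnion_filter]; exact P.measurableSet_image σ A)]
  exact indicatorL2_congr _ _ (P.image_eq_biUnion_filter σ A)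

theorem indicatorL2_image_mem (P : EqualPartition μ) (σ : Equiv.Perm (Fin P.q)) (A : Set α) :
    indicatorL2 μ (P.measurableSet_image σ A) ∈ P.stepSpace := by
  rw [indicatorL2_image]
  exact Submodule.sum_mem _ fun j _ => P.cellIndicator_mem _

theorem stepKoopman_zpow_indicatorL2_image (P : EqualPartition μ) (hμ : μ ≠ 0)
    (σ : Equiv.Perm (Fin P.q)) (k : ℤ) (A : Set α) :
    ((P.stepKoopman hμ σ ^ k) ⟨_, P.indicatorL2_image_mem 1 A⟩ : Lp ℂ 2 μ) =
      indicatorL2 μ (P.measurableSet_image (σ ^ (-k)) A) := by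
  classical
  have h1 : (⟨_, P.indicatorL2_image_mem 1 A⟩ : P.stepSpace) =
      ∑ j ∈ Finset.univ.filter (fun j => (P.cell j ∩ A).Nonempty),
        ((Real.sqrt P.mass : ℝ) : ℂ) • P.unitCell j := by
    apply Subtype.ext
    simp only [indicatorL2_image, Submodule.coe_sum, Submodule.coe_smul,
      ← sqrt_mass_smul_unitCell P hμ, Equiv.Perm.coe_one, id_eq]
  rw [h1, map_sum]
  simp only [map_smul, stepKoopman_zpow_unitCell, indicatorL2_image, Submodule.coe_sum,
    Submodule.coe_smul, ← sqrt_mass_smul_unitCell P hμ]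

end EqualPartition

/-! ### Strong convergence of the powers. -/

section Approximation

variable {α : Type*} [MetricSpace α]

theorem continuous_zpow [CompactSpace α] {T : Equiv.Perm α} (hT : Continuous T) (k : ℤ) :
    Continuous (T ^ k : Equiv.Perm α) := by
  have hT' : Continuous T.symm := hT.homeoOfEquivCompactToT2.symm.continuous
  induction k using Int.induction_on with
  | zero => exact continuous_id
  | succ k ih => rw [zpow_add_one]; exact ih.comp hT
  | pred k ih => rw [zpow_sub_one]; exact ih.comp hT'

variable [MeasurableSpace α] {μ : Measure α}

theorem PeriodicallyApproximates.tendsto_hausdorffDist {T : Equiv.Perm α}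
    {P : ℕ → EqualPartition μ} {σ : ∀ n, Equiv.Perm (Fin (P n).q)}
    (hσ : PeriodicallyApproximates T P σ) (k : ℤ) {A : Set α} (hA : IsCompact A) :
    Tendsto (fun n => Metric.hausdorffDist ((T ^ k : Equiv.Perm α) '' A)
      ((P n).image (σ n ^ k) A)) atTop (𝓝 0) := by
  refine squeeze_zero (fun _ => Metric.hausdorffDist_nonneg) (fun n => ?_) (hσ k.natAbs A hA)
  exact Finset.single_le_sum
    (f := fun l : ℤ => Metric.hausdorffDist ((T ^ l : Equiv.Perm α) '' A)
      ((P n).image (σ n ^ l) A))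
    (fun _ _ => Metric.hausdorffDist_nonneg) (by rw [Finset.mem_Icc]; omega)

variable [CompactSpace α] [BorelSpace α] [IsFiniteMeasure μ]

/-- The sets `T_n ^ k (A_n)` converge to `T ^ k (A)` in `L²`. -/
theorem PeriodicallyApproximates.tendsto_indicatorL2_image {T : Equiv.Perm α}
    (hTc : Continuous T) (hT : IsMeasurePreservingAutomorphism T μ)
    {P : ℕ → EqualPartition μ} {σ : ∀ n, Equiv.Perm (Fin (P n).q)}
    (hσ : PeriodicallyApproximates T P σ) (k : ℤ) {A : Set α} (hA : IsCompact A)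
    (hAne : A.Nonempty) :
    Tendsto (fun n => indicatorL2 μ ((P n).measurableSet_image (σ n ^ (-k)) A)) atTop
      (𝓝 ((koopman hT ^ k) (indicatorL2 μ hA.measurableSet))) := by
  have hK := hA.image (continuous_zpow hTc (-k))
  have himage : (T ^ (-k) : Equiv.Perm α) '' A = (T ^ k : Equiv.Perm α) ⁻¹' A := by
    rw [zpow_neg]
    exact Equiv.image_eq_preimage_symm _ _
  -- The left side is `μ(A)` by invariance; the right side equals `μ(A_n)`, since the permutation
  -- can be replaced by the identity, and `A ⊆ A_n`.
  have hle : ∀ n, μ ((T ^ (-k) : Equiv.Perm α) '' A) ≤ μ ((P n).image (σ n ^ (-k)) A) := by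
    intro n
    rw [himage, (hT.zpow k).measure_preimage hA.measurableSet.nullMeasurableSet,
      (P n).measure_image_eq _ 1]
    exact measure_mono ((P n).subset_image_one A)
  have h := tendsto_measure_symmDiff_of_hausdorffDist hK (hAne.image _)
    (fun n => (P n).measurableSet_image (σ n ^ (-k)) A) (fun n => (P n).image_nonempty _ hAne)
    hle (hσ.tendsto_hausdorffDist (-k) hA)
  rw [koopman_zpow_indicatorL2, ← indicatorL2_congr hK.measurableSet _ himage]
  exact tendsto_indicatorConstLp_set (by simp) h

/-- The powers of the discrete Koopman operators converge strongly. -/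
theorem PeriodicallyApproximates.tendsto_stepKoopman_zpow {T : Equiv.Perm α} (hμ : μ ≠ 0)
    (hTc : Continuous T) (hT : IsMeasurePreservingAutomorphism T μ)
    {P : ℕ → EqualPartition μ} {σ : ∀ n, Equiv.Perm (Fin (P n).q)}
    (hσ : PeriodicallyApproximates T P σ) (k : ℤ) (g : Lp ℂ 2 μ) :
    Tendsto (fun n => (koopman hT ^ k) g -
      (((P n).stepKoopman hμ (σ n) ^ k) ((P n).average g) : Lp ℂ 2 μ)) atTop (𝓝 0) := by
  let L : ℕ → Lp ℂ 2 μ →ₗ[ℂ] Lp ℂ 2 μ := fun n =>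
    ((koopman hT ^ k).toLinearEquiv : Lp ℂ 2 μ →ₗ[ℂ] Lp ℂ 2 μ) -
      (P n).stepSpace.subtype ∘ₗ
        (((P n).stepKoopman hμ (σ n) ^ k).toLinearEquiv : (P n).stepSpace →ₗ[ℂ] (P n).stepSpace) ∘ₗ
        ((P n).stepSpace.orthogonalProjectionOnto : Lp ℂ 2 μ →ₗ[ℂ] (P n).stepSpace)
  have hLapply : ∀ n g, L n g = (koopman hT ^ k) g -
      (((P n).stepKoopman hμ (σ n) ^ k) ((P n).average g) : Lp ℂ 2 μ) := by
    intro n g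
    rw [(P n).average_eq_orthogonalProjection hμ]
    rfl
  have haverage : ∀ n g, ‖(P n).average g‖ ≤ ‖g‖ := by
    intro n g
    rw [(P n).average_eq_orthogonalProjection hμ]
    exact (P n).stepSpace.norm_orthogonalProjectionOnto_apply_le g
  have hbound : ∀ n g, ‖L n g‖ ≤ 2 * ‖g‖ := by
    intro n g
    rw [hLapply]
    refine (norm_sub_le _ _).trans ?_
    rw [LinearIsometryEquiv.norm_map, ← Submodule.coe_norm, LinearIsometryEquiv.norm_map, two_mul]
    gcongr
    exact haverage n g
  have hcompact : ∀ f ∈ {f : Lp ℂ 2 μ | ∃ (A : Set α) (hA : IsCompact A),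
      f = indicatorL2 μ hA.measurableSet}, Tendsto (fun n => L n f) atTop (𝓝 0) := by
    rintro _ ⟨A, hA, rfl⟩
    rcases A.eq_empty_or_nonempty with rfl | hAne
    · simp
    · have h1 := hσ.tendsto_indicatorL2_image hTc hT k hA hAne
      -- Exponent `0` says that the indicators of `A_n` converge to that of `A`.
      have h2 := hσ.tendsto_indicatorL2_image hTc hT 0 hA hAne
      have h3 := (tendsto_const_nhds (x := (koopman hT ^ k) (indicatorL2 μ hA.measurableSet))).sub h1
      rw [sub_self] at h3
      have h4 : Tendsto (fun n => ‖indicatorL2 μ ((P n).measurableSet_image 1 A) -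
          indicatorL2 μ hA.measurableSet‖) atTop (𝓝 0) := by
        have := (h2.sub_const (indicatorL2 μ hA.measurableSet)).norm
        simpa using this
      -- The operator acts explicitly on the indicator of `A_n`, but the claim concerns the average
      -- of the indicator of `A`. The former is its own average, and averaging is a contraction, so
      -- exchanging them costs at most the distance in `h4`.
      have h5 : Tendsto (fun n => (((P n).stepKoopman hμ (σ n) ^ k)
          (⟨_, (P n).indicatorL2_image_mem 1 A⟩ - (P n).average (indicatorL2 μ hA.measurableSet)) :
            Lp ℂ 2 μ)) atTop (𝓝 0) := by
        refine squeeze_zero_norm (fun n => ?_) h4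
        have h6 : (⟨_, (P n).indicatorL2_image_mem 1 A⟩ : (P n).stepSpace) =
            (P n).average (indicatorL2 μ ((P n).measurableSet_image 1 A)) := by
          rw [(P n).average_eq_orthogonalProjection hμ]
          exact ((P n).stepSpace.orthogonalProjectionOnto_mem_subspace_eq_self
            ⟨_, (P n).indicatorL2_image_mem 1 A⟩).symm
        have h7 : ∀ f h, (P n).average f - (P n).average h = (P n).average (f - h) := by
          intro f h
          simp only [(P n).average_eq_orthogonalProjection hμ, map_sub]
        rw [← Submodule.coe_norm, LinearIsometryEquiv.norm_map, h6, h7]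
        exact haverage n _
      have h8 := h3.add h5
      rw [add_zero] at h8
      refine h8.congr fun n => ?_
      rw [hLapply, map_sub, Submodule.coe_sub, (P n).stepKoopman_zpow_indicatorL2_image]
      abel
  exact (tendsto_zero_of_dense_span L hbound dense_span_indicatorL2_isCompact hcompact g).congr
    fun n => hLapply n g

end Approximation

/-! ### The discrete functional calculus and convergence of the calculi. -/

namespace EqualPartition.EigenDecomposition

variable {α : Type*} [MetricSpace α] [MeasurableSpace α] [BorelSpace α] {μ : Measure α}
  [IsFiniteMeasure μ] {P : EqualPartition μ} {σ : Equiv.Perm (Fin P.q)}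

/-- By Parseval in the eigenbasis, each coefficient of `h` is multiplied by a number of modulus at
most `C`. The bound does not depend on the partition. -/
theorem norm_integral_le (d : P.EigenDecomposition σ) {φ : Angle → ℂ} {C : ℝ} (hC : 0 ≤ C)
    (hφ : ∀ θ, ‖φ θ‖ ≤ C) (h : P.stepSpace) : ‖d.integral φ h‖ ≤ C * ‖h‖ := by
  refine le_of_sq_le_sq ?_ (by positivity)
  rw [← d.basis.sum_sq_norm_inner_right, mul_pow, ← d.basis.sum_sq_norm_inner_right h,
    Finset.mul_sum]
  refine Finset.sum_le_sum fun k _ => ?_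
  simp only [integral, smul_smul]
  rw [d.basis.orthonormal.inner_right_fintype, norm_mul, mul_pow]
  gcongr
  exact hφ _

theorem integral_exp (d : P.EigenDecomposition σ) (hμ : μ ≠ 0) (k : ℤ) (h : P.stepSpace) :
    d.integral (fun θ => Complex.exp (Complex.I * (k : ℂ) * ((θ : ℝ) : ℂ))) h =
      (P.stepKoopman hμ σ ^ k) h := by
  conv_rhs => rw [← d.basis.sum_repr' h]
  rw [map_sum, integral]
  refine Finset.sum_congr rfl fun j _ => ?_
  rw [map_smul, zpow_apply_eigenvector _
    ((P.discreteKoopman_eq_stepKoopman hμ σ _).symm.trans (d.eigen j)), smul_comm]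

end EqualPartition.EigenDecomposition

/-- With `g` fixed, the difference of the two calculi is linear in the function on the circle and
bounded by `2‖g‖` times its supremum norm, for all `n`. It tends to zero on characters by
convergence of powers, hence on all continuous functions by density. -/
theorem tendsto_norm_integral_sub {α : Type*} [MetricSpace α] [CompactSpace α] [MeasurableSpace α]
    [BorelSpace α] {μ : Measure α} [IsFiniteMeasure μ] (hμ : μ ≠ 0) {T : Equiv.Perm α}
    (hTc : Continuous T) (hT : IsMeasurePreservingAutomorphism T μ)
    {P : ℕ → EqualPartition μ} {σ : ∀ n, Equiv.Perm (Fin (P n).q)}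
    (hσ : PeriodicallyApproximates T P σ)
    {S : ProjectionValuedMeasure Angle (Lp ℂ 2 μ)} (hS : IsSpectralMeasure S (koopman hT))
    (d : ∀ n, (P n).EigenDecomposition (σ n)) {φ : ℝ → ℂ} (hφ : Continuous φ)
    (hper : Function.Periodic φ (2 * Real.pi)) (g : Lp ℂ 2 μ) :
    Tendsto (fun n => ‖S.integral (fun θ => φ θ) g -
      ((d n).integral (fun θ => φ θ) ((P n).average g) : Lp ℂ 2 μ)‖) atTop (𝓝 0) := by
  obtain ⟨Ψ, hΨ⟩ := exists_starAlgHom_fourier (koopman hT)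
  let L : ℕ → C(AddCircle (2 * Real.pi), ℂ) →ₗ[ℂ] Lp ℂ 2 μ := fun n =>
    { toFun := fun F => Ψ F g - ((d n).integral
        (fun θ => F ((θ : ℝ) : AddCircle (2 * Real.pi))) ((P n).average g) : Lp ℂ 2 μ)
      map_add' := fun F G => by
        simp only [EqualPartition.EigenDecomposition.integral, ContinuousMap.add_apply, add_smul,
          Finset.sum_add_distrib, Submodule.coe_add, map_add, add_apply]
        abel
      map_smul' := fun c F => by
        simp only [EqualPartition.EigenDecomposition.integral, ContinuousMap.smul_apply,
          smul_assoc, ← Finset.smul_sum, Submodule.coe_smul, map_smul, smul_apply, smul_sub,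
          RingHom.id_apply] }
  have hbound : ∀ n F, ‖L n F‖ ≤ (2 * ‖g‖) * ‖F‖ := by
    intro n F
    have h1 : ‖Ψ F g‖ ≤ ‖F‖ * ‖g‖ := (ContinuousLinearMap.le_opNorm _ _).trans
      (by gcongr; exact NonUnitalStarAlgHom.norm_apply_le Ψ F)
    have h2 := (d n).norm_integral_le (φ := fun θ => F ((θ : ℝ) : AddCircle (2 * Real.pi)))
      (norm_nonneg F) (fun θ => F.norm_coe_le_norm _) ((P n).average g)
    have h3 : ‖(P n).average g‖ ≤ ‖g‖ := by
      rw [(P n).average_eq_orthogonalProjection hμ]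
      exact (P n).stepSpace.norm_orthogonalProjectionOnto_apply_le g
    calc ‖L n F‖ ≤ ‖Ψ F g‖ + ‖(d n).integral (fun θ => F ((θ : ℝ) : AddCircle (2 * Real.pi)))
          ((P n).average g)‖ := norm_sub_le _ _
      _ ≤ ‖F‖ * ‖g‖ + ‖F‖ * ‖g‖ := add_le_add h1 (h2.trans (by gcongr))
      _ = (2 * ‖g‖) * ‖F‖ := by ring
  have hfourier : ∀ F ∈ Set.range (@fourier (2 * Real.pi)),
      Tendsto (fun n => L n F) atTop (𝓝 0) := by
    rintro _ ⟨k, rfl⟩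
    refine (hσ.tendsto_stepKoopman_zpow hμ hTc hT k g).congr fun n => ?_
    rw [← (d n).integral_exp hμ]
    simp_rw [← fourier_coe_eq_exp]
    change _ = Ψ (fourier k) g - _
    rw [hΨ]
    rfl
  -- Periodicity makes `φ` descend to a continuous function on the circle, where the density
  -- argument takes place.
  let F : C(AddCircle (2 * Real.pi), ℂ) := ⟨hper.lift, continuous_coinduced_dom.mpr hφ⟩
  have hF := (tendsto_zero_of_dense_span L hbound dense_span_fourier hfourier F).norm
  rw [norm_zero] at hF
  refine hF.congr fun n => ?_
  rw [show S.integral (fun θ : Angle => φ θ) = Ψ F from (hS.hasIntegral hΨ F).integral_eq]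
  rfl

end KoopmanSpectra

end

theorem mainTheorem1
    {E : Type*} [NormedAddCommGroup E] [NormedSpace ℝ E] [FiniteDimensional ℝ E]
    [MeasurableSpace E] [BorelSpace E] (lam : Measure E) [lam.IsAddHaarMeasure]
    (X : Set E) (hX : IsCompact X)
    (μ : Measure X) [IsFiniteMeasure μ]
    (hac : μ.map (Subtype.val : X → E) ≪ lam) (hsupp : μ.support = Set.univ)
    (T : Equiv.Perm X) (hTc : Continuous T)
    (hT : KoopmanSpectra.IsMeasurePreservingAutomorphism T μ)
    (P : ℕ → KoopmanSpectra.EqualPartition μ) (hP : KoopmanSpectra.IsRefiningSequence P)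
    (σ : ∀ n, Equiv.Perm (Fin (P n).q))
    (hσ : KoopmanSpectra.PeriodicallyApproximates T P σ) :
    (∃ S : KoopmanSpectra.ProjectionValuedMeasure KoopmanSpectra.Angle (Lp ℂ 2 μ),
      KoopmanSpectra.IsSpectralMeasure S (KoopmanSpectra.koopman hT)) ∧
    (∀ n, Nonempty ((P n).EigenDecomposition (σ n))) ∧
    ∀ S : KoopmanSpectra.ProjectionValuedMeasure KoopmanSpectra.Angle (Lp ℂ 2 μ),
      KoopmanSpectra.IsSpectralMeasure S (KoopmanSpectra.koopman hT) →
    ∀ d : ∀ n, (P n).EigenDecomposition (σ n),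
    ∀ φ : ℝ → ℂ, ContDiff ℝ ∞ φ → Function.Periodic φ (2 * Real.pi) →
    ∀ g : Lp ℂ 2 μ,
      Tendsto (fun n => ‖S.integral (fun θ => φ θ) g -
          ((d n).integral (fun θ => φ θ) ((P n).average g) : Lp ℂ 2 μ)‖)
        atTop (𝓝 0) := by
  have : CompactSpace X := isCompact_iff_compactSpace.1 hX
  -- The zero measure has empty support, whereas the space has a point: strict monotonicity gives
  -- `q(1) > q(0) ≥ 0`, so the partition of index 1 has a cell, and cells are nonempty.
  have hμ : μ ≠ 0 := by
    rintro rfl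
    have hq : 0 < (P 1).q := (Nat.zero_le _).trans_lt (hP.strictMono_q zero_lt_one)
    obtain ⟨x, -⟩ := ((P 1).isConnected_cell ⟨0, hq⟩).nonempty
    have hx : x ∈ (0 : Measure X).support := by rw [hsupp]; trivial
    simp at hx
  exact ⟨KoopmanSpectra.exists_isSpectralMeasure _,
    fun n => (P n).nonempty_eigenDecomposition hμ (σ n),
    fun S hS d φ hφ hper g =>
      KoopmanSpectra.tendsto_norm_integral_sub hμ hTc hT hσ hS d hφ.continuous hper g⟩
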